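/- **Conventions.** Composition in categories is written from left to right. All categories playing the role of algebraic structures are small, and all semigroups and small categories below are taken in one fixed universe. *Semigroups.* A semigroup $S$ is *regular* if every $a\in S$ has an $x\in S$ with $axa=a$, $xax=x$; it is *right reductive* if $a\mapsto\lambda_a$, $\lambda_a(x)=ax$, is injective. $\mathbf{RRS}$ is the full subcategory of the category of semigroups and homomorphisms consisting of the right reductive regular semigroups. On a regular semigroup put $a\leqslant_r b$ iff $a\in bS$, let $\mathscr R$ be the induced equivalence and order $S/\mathscr R$ by $\leqslant_r$; write $R_a$ for the class of $a$. *Normal categories.* A *category with subobjects* is a small category $\mathcal C$ with a subcategory $\mathcal P$ of *inclusions* on the same objects such that $\mathcal P$ is a strict preorder (at most one morphism between two objects, and only identities are isomorphisms), every inclusion is a monomorphism in $\mathcal C$, and $f=hg$ with $f,g\in\mathcal P$ implies $h\in\mathcal P$. Write $a\preceq b$ if there is an inclusion $j(a,b)\colon a\to b$. A *retraction* is a $q$ with $jq=1$ for some inclusion $j$. A *cone* $\gamma$ with vertex $z_\gamma$ is a family $\gamma(c)\colon c\to z_\gamma$, $c\in v\mathcal C$, with $j(a,b)\gamma(b)=\gamma(a)$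 whenever $a\preceq b$ and with at least one $\gamma(c)$ an isomorphism. $\mathcal C$ is *normal* if every inclusion $j$ has a $q$ with $jq=1$, every morphism is of the form $quj$ with $q$ a retraction, $u$ an isomorphism and $j$ an inclusion, and for each object $c$ there is a cone $\mu$ with vertex $c$ and $\mu(c)=1_c$. Every morphism $f$ of a normal category is uniquely $f=f^\circ j_f$ with $f^\circ$ an epimorphism and $j_f$ an inclusion. For a cone $\gamma$ and an epimorphism $f$ starting at $z_\gamma$ let $(\gamma*f)(c)=\gamma(c)f$. The set $\widehat{\mathcal C}$ of all cones is a regular semigroup under $\gamma\cdot\delta=\gamma*(\delta(z_\gamma))^\circ$. *Connected categories.* A *connected category* $\mathcal C_{\mathfrak D}$ is a normal category $\mathcal C$ with a down-set $\mathfrak D$ of $\widehat{\mathcal C}/\mathscr R$ such that every object $c$ is connected by some $\mathfrak d\in\mathfrak D$, i.e. $\mathfrak d$ contains an idempotent cone with vertex $c$ (it is then unique and denoted $\epsilon(c,\mathfrak d)$). A *CC-morphism* $\mathcal C_{\mathfrak D}\to\mathcal C'_{\mathfrak D'}$ is a pair $(F,G)$ of an inclusion preserving functor $F\colon\mathcal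 C\to\mathcal C'$ and an order preserving map $G\colon\mathfrak D\to\mathfrak D'$ such that, whenever $c$ is connected by $\mathfrak d$, $F(c)$ is connected by $G(\mathfrak d)$ and $F(\epsilon(c,\mathfrak d)(c'))=\epsilon(F(c),G(\mathfrak d))(F(c'))$ for all objects $c'$. $\mathbf{CC}$ is the category of connected categories and CC-morphisms. *The functor $\mathtt C\colon\mathbf{RRS}\to\mathbf{CC}$.* For a regular semigroup $S$, $\mathbb R(S)$ is the category whose objects are the right ideals $eS$, $e\in E(S)$, and whose morphisms $eS\to fS$ are the maps $l(e,u,f)\colon x\mapsto ux$ with $u\in fSe$; its inclusions are the inclusion maps. The *principal cone* $l^a$ has vertex $aS$ and components $l^a(eS)\colon x\mapsto ax$. Let $\mathfrak L$ be the set of $\mathscr R$-classes in $\widehat{\mathbb R(S)}$ (equivalently, $\mathscr L$-classes in the opposite semigroup $\widehat{\mathbb R(S)}^{\mathrm{op}}$) of the cones $l^e$, $e\in E(S)$. For $S$ in $\mathbf{RRS}$, $\mathtt C(S)=\mathbb R(S)_{\mathfrak L}$; for a homomorphism $\phi\colon S\to S'$, $\mathtt C(\phi)=(F_\phi,G_\phi)$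 with $F_\phi(eS)=\phi(e)S'$, $F_\phi(l(e,u,f))=l(\phi(e),\phi(u),\phi(f))$, and $G_\phi$ sends the class of $l^e$ to the class of $l^{\phi(e)}$. *The functor $\mathtt S\colon\mathbf{CC}\to\mathbf{RRS}$.* The *connection semigroup* of $\mathcal C_{\mathfrak D}$ is the subsemigroup $\widehat{\mathcal C_{\mathfrak D}}=\{\gamma\in\widehat{\mathcal C}: R_\gamma\in\mathfrak D\}$ of $\widehat{\mathcal C}$, and $\mathtt S(\mathcal C_{\mathfrak D})$ is the *dual connection semigroup*, i.e. the opposite semigroup of $\widehat{\mathcal C_{\mathfrak D}}$. For a CC-morphism $m=(F,G)$, $\mathtt S(m)$ is the homomorphism $\epsilon(c,\mathfrak d)*u\mapsto\epsilon(F(c),G(\mathfrak d))*F(u)$, $u$ an isomorphism (every cone in $\widehat{\mathcal C_{\mathfrak D}}$ is of the form $\epsilon(c,\mathfrak d)*u$ and the value does not depend on the representation). **Theorem.** $\mathtt C$ and $\mathtt S$ are well-defined (covariant) functors, and they are mutually quasi-inverse: there is an equivalence of categories $\mathbf{RRS}\simeq\mathbf{CC}$ whose functor is $\mathtt C\colon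 S\mapsto\mathbb R(S)_{\mathfrak L}$ and whose inverse is $\mathtt S\colon \mathcal C_{\mathfrak D}\mapsto\widehat{\mathcal C_{\mathfrak D}}^{\mathrm{op}}$. -/

import Mathlib

open CategoryTheory

universe u

namespace ConnCat

/-! ### Regular semigroups and the poset of `R`-classes -/

/-- A semigroup is regular if every element has an inverse `x`, i.e. `a x a = a`, `x a x = x`. -/
class RegularSemigroup (S : Type u) [Semigroup S] : Prop where
  exists_inverse : ∀ a : S, ∃ x : S, a * x * a = a ∧ x * a * x = x

/-- A semigroup is right reductive if the anti-regular representation, sending `a` to the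
left translation `x ↦ a x`, is injective. -/
class RightReductive (S : Type u) [Semigroup S] : Prop where
  injective : Function.Injective (fun a : S => fun x : S => a * x)

/-- The quasi-order `a ≤ᵣ b ↔ a ∈ b S`. -/
def RLe {S : Type u} [Semigroup S] (a b : S) : Prop := ∃ x : S, a = b * x

theorem RLe.refl {S : Type u} [Semigroup S] [RegularSemigroup S] (a : S) : RLe a a := by
  obtain ⟨x, hx, -⟩ := RegularSemigroup.exists_inverse a
  exact ⟨x * a, by rw [← mul_assoc, hx]⟩

theorem RLe.trans {S : Type u} [Semigroup S] {a b c : S} (h : RLe a b) (h' : RLe b c) :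
    RLe a c := by
  obtain ⟨x, rfl⟩ := h
  obtain ⟨y, rfl⟩ := h'
  exact ⟨y * x, mul_assoc _ _ _⟩

/-- Green's relation `R` on a regular semigroup. -/
def greenR (S : Type u) [Semigroup S] [RegularSemigroup S] : Setoid S where
  r a b := RLe a b ∧ RLe b a
  iseqv :=
    { refl := fun a => ⟨RLe.refl a, RLe.refl a⟩
      symm := fun h => ⟨h.2, h.1⟩
      trans := fun h h' => ⟨h.1.trans h'.1, h'.2.trans h.2⟩ }

/-- The set `S / R` of `R`-classes of a regular semigroup. -/
def RClass (S : Type u) [Semigroup S] [RegularSemigroup S] : Type u := Quotient (greenR S)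

/-- The `R`-class of an element. -/
def RClass.of {S : Type u} [Semigroup S] [RegularSemigroup S] (a : S) : RClass S :=
  Quotient.mk (greenR S) a

/-- The partial order on `S / R`: the class of `a` is below the class of `b` iff `a ≤ᵣ b`. -/
instance {S : Type u} [Semigroup S] [RegularSemigroup S] : PartialOrder (RClass S) where
  le := Quotient.lift₂ RLe (fun _ _ _ _ h h' => propext
    ⟨fun k => (h.2.trans k).trans h'.1, fun k => (h.1.trans k).trans h'.2⟩)
  le_refl a := Quotient.inductionOn a RLe.refl
  le_trans a b c := Quotient.inductionOn₃ a b c (fun _ _ _ h h' => RLe.trans h h')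
  le_antisymm a b := Quotient.inductionOn₂ a b (fun _ _ h h' => Quotient.sound ⟨h, h'⟩)

theorem RClass.of_le_of {S : Type u} [Semigroup S] [RegularSemigroup S] {a b : S} :
    RClass.of a ≤ RClass.of b ↔ RLe a b := Iff.rfl

theorem RClass.exists_of {S : Type u} [Semigroup S] [RegularSemigroup S] (d : RClass S) :
    ∃ a, RClass.of a = d := Quotient.exists_rep d

/-! ### Categories with subobjects and normal categories -/

/-- A small category with subobjects: a small category together with a wide subcategory of
`inclusions` which is a strict preorder, consists of monomorphisms, and contains `h` whenever
it contains `g` and `h ≫ g`. -/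
class CategoryWithSubobjects (C : Type u) [SmallCategory C] where
  incl : MorphismProperty C
  incl_id : ∀ c : C, incl (𝟙 c)
  incl_comp : ∀ {a b c : C} (f : a ⟶ b) (g : b ⟶ c), incl f → incl g → incl (f ≫ g)
  incl_unique : ∀ {a b : C} (f g : a ⟶ b), incl f → incl g → f = g
  incl_antisymm : ∀ {a b : C} (f : a ⟶ b) (g : b ⟶ a), incl f → incl g → a = b
  incl_mono : ∀ {a b : C} (f : a ⟶ b), incl f → Mono f
  incl_of_comp : ∀ {a b c : C} (h : a ⟶ b) (g : b ⟶ c), incl (h ≫ g) → incl g → incl h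

section Subobjects

variable {C : Type u} [SmallCategory C] [CategoryWithSubobjects C]

/-- The morphism `j` is an inclusion. -/
def IsIncl {a b : C} (j : a ⟶ b) : Prop := CategoryWithSubobjects.incl j

/-- A retraction is a right inverse `q` of an inclusion `j`, i.e. `j ≫ q = 𝟙`. -/
def IsRetraction {a b : C} (q : b ⟶ a) : Prop := ∃ j : a ⟶ b, IsIncl j ∧ j ≫ q = 𝟙 a

/-- `f = q u j` with `q` a retraction, `u` an isomorphism and `j` an inclusion. -/
def HasNormalFactorisation {a b : C} (f : a ⟶ b) : Prop :=
  ∃ (a' b' : C) (q : a ⟶ a') (u : a' ⟶ b') (j : b' ⟶ b),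
    IsRetraction q ∧ IsIso u ∧ IsIncl j ∧ f = q ≫ u ≫ j

variable (C) in
/-- A cone in a category with subobjects. -/
@[ext]
structure NCone where
  vertex : C
  app : ∀ c : C, c ⟶ vertex
  compat : ∀ {a b : C} (j : a ⟶ b), IsIncl j → j ≫ app b = app a
  exists_iso : ∃ c : C, IsIso (app c)

end Subobjects

/-- A normal category: inclusions split, morphisms have normal factorisations, and each object
`c` is the vertex of a cone with identity component at `c`. -/
class NormalCategory (C : Type u) [SmallCategory C] [CategoryWithSubobjects C] : Prop where
  incl_split : ∀ {a b : C} (j : a ⟶ b), IsIncl j → ∃ q : b ⟶ a, j ≫ q = 𝟙 a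
  exists_normalFactorisation : ∀ {a b : C} (f : a ⟶ b), HasNormalFactorisation f
  exists_cone : ∀ c : C, ∃ μ : NCone C, μ.vertex = c ∧ μ.app μ.vertex = 𝟙 μ.vertex

section Normal

variable {C : Type u} [SmallCategory C] [CategoryWithSubobjects C]

theorem IsRetraction.epi {a b : C} {q : b ⟶ a} (h : IsRetraction q) : Epi q := by
  obtain ⟨j, -, h⟩ := h
  exact ⟨fun f g hfg => by
    have : j ≫ q ≫ f = j ≫ q ≫ g := by rw [hfg]
    simpa [← Category.assoc, h] using this⟩

theorem IsIncl.mono {a b : C} {j : a ⟶ b} (h : IsIncl j) : Mono j :=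
  CategoryWithSubobjects.incl_mono j h

/-- An epimorphism followed by an inclusion. -/
theorem exists_canonicalFactorisation [NormalCategory C] {a b : C} (f : a ⟶ b) :
    ∃ (z : C) (p : a ⟶ z) (j : z ⟶ b), Epi p ∧ IsIncl j ∧ f = p ≫ j := by
  obtain ⟨a', b', q, u, j, hq, hu, hj, rfl⟩ :=
    NormalCategory.exists_normalFactorisation f
  have := hq.epi
  exact ⟨b', q ≫ u, j, inferInstance, hj, by simp⟩

/-- The image of a morphism `f`: the middle object of its canonical factorisation `f = p j`
into an epimorphism followed by an inclusion. -/
noncomputable def im [NormalCategory C] {a b : C} (f : a ⟶ b) : C :=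
  (exists_canonicalFactorisation f).choose

/-- The epimorphic component `f°` of a morphism `f`. -/
noncomputable def epiPart [NormalCategory C] {a b : C} (f : a ⟶ b) : a ⟶ im f :=
  (exists_canonicalFactorisation f).choose_spec.choose

/-- The inclusion of the image of `f`. -/
noncomputable def imIncl [NormalCategory C] {a b : C} (f : a ⟶ b) : im f ⟶ b :=
  (exists_canonicalFactorisation f).choose_spec.choose_spec.choose

theorem canonicalFactorisation_spec [NormalCategory C] {a b : C} (f : a ⟶ b) :
    Epi (epiPart f) ∧ IsIncl (imIncl f) ∧ f = epiPart f ≫ imIncl f :=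
  (exists_canonicalFactorisation f).choose_spec.choose_spec.choose_spec

instance [NormalCategory C] {a b : C} (f : a ⟶ b) : Epi (epiPart f) :=
  (canonicalFactorisation_spec f).1

/-- Every epimorphism of a normal category is a retraction followed by an isomorphism. -/
theorem epi_factor [NormalCategory C] {a b : C} (p : a ⟶ b) [Epi p] :
    ∃ (a' : C) (q : a ⟶ a') (u : a' ⟶ b), IsRetraction q ∧ IsIso u ∧ p = q ≫ u := by
  obtain ⟨a', b', q, u, j, hq, hu, hj, rfl⟩ :=
    NormalCategory.exists_normalFactorisation p
  obtain ⟨r, hr⟩ := NormalCategory.incl_split j hj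
  have hje : Epi j := by
    have : Epi ((q ≫ u) ≫ j) := by simpa using ‹Epi (q ≫ u ≫ j)›
    exact epi_of_epi (q ≫ u) j
  have hrj : r ≫ j = 𝟙 b := by
    rw [← cancel_epi j, ← Category.assoc, hr]; simp
  have hri : IsIncl r := CategoryWithSubobjects.incl_of_comp r j
    (by rw [hrj]; exact CategoryWithSubobjects.incl_id b) hj
  obtain rfl := CategoryWithSubobjects.incl_antisymm j r hj hri
  obtain rfl : j = 𝟙 _ := CategoryWithSubobjects.incl_unique _ _ hj
    (CategoryWithSubobjects.incl_id _)
  exact ⟨a', q, u, hq, hu, by simp⟩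

/-- The canonical factorisation is unique. -/
theorem canonicalFactorisation_unique [NormalCategory C] {a b z : C} (f : a ⟶ b)
    (p : a ⟶ z) (j : z ⟶ b) (hp : Epi p) (hj : IsIncl j) (h : f = p ≫ j) :
    ∃ e : z = im f, epiPart f = p ≫ eqToHom e ∧ imIncl f = eqToHom e.symm ≫ j := by
  have key : ∀ {x y : C} (p : a ⟶ x) (j : x ⟶ b) (p' : a ⟶ y) (j' : y ⟶ b), Epi p →
      IsIncl j → IsIncl j' → p ≫ j = p' ≫ j' → ∃ i : x ⟶ y, IsIncl i := by
    intro x y p j p' j' hp hj hj' e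
    obtain ⟨a', q, u, ⟨s, -, hs⟩, hu, rfl⟩ := epi_factor p
    refine ⟨inv u ≫ s ≫ p', CategoryWithSubobjects.incl_of_comp _ j' ?_ hj'⟩
    have : (inv u ≫ s ≫ p') ≫ j' = j := by
      simp only [Category.assoc, ← e]
      rw [← Category.assoc s q, hs]; simp
    rw [this]; exact hj
  obtain ⟨hp', hj', h'⟩ := canonicalFactorisation_spec f
  obtain ⟨i, hi⟩ := key p j _ _ hp hj hj' (h.symm.trans h')
  obtain ⟨i', hi'⟩ := key _ _ p j hp' hj' hj (h'.symm.trans h)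
  have e := CategoryWithSubobjects.incl_antisymm i i' hi hi'
  refine ⟨e, ?_⟩
  generalize epiPart f = p' at *
  generalize imIncl f = j' at *
  generalize im f = z' at *
  subst e
  obtain rfl := CategoryWithSubobjects.incl_unique _ _ hj hj'
  have := hj.mono
  exact ⟨by simpa using (cancel_mono j).1 (h'.symm.trans h), by simp⟩

/-! ### The semigroup of cones -/

namespace NCone

/-- The cone `γ * f` for an epimorphism `f` starting at the vertex of `γ`. -/
def star [NormalCategory C] (γ : NCone C) {z : C} (f : γ.vertex ⟶ z) (hf : Epi f) :
    NCone C where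
  vertex := z
  app c := γ.app c ≫ f
  compat j hj := by rw [← Category.assoc, γ.compat j hj]
  exists_iso := by
    obtain ⟨c, hc⟩ := γ.exists_iso
    obtain ⟨c', q, u, ⟨j, hj, hjq⟩, hu, e⟩ := epi_factor (γ.app c ≫ f)
    refine ⟨c', ?_⟩
    have : γ.app c' ≫ f = u := by
      rw [← γ.compat j hj, Category.assoc, e, ← Category.assoc, hjq, Category.id_comp]
    rw [this]; exact hu

/-- The product of cones: `γ · δ = γ * (δ(z_γ))°`. -/
noncomputable instance [NormalCategory C] : Mul (NCone C) where
  mul γ δ := γ.star (epiPart (δ.app γ.vertex)) inferInstance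

/-- Two cones which agree after composing with inclusions of their vertices into a common
object are equal. -/
theorem eq_of_incl {γ δ : NCone C} {b : C} (i : γ.vertex ⟶ b) (k : δ.vertex ⟶ b)
    (hi : IsIncl i) (hk : IsIncl k) (h : ∀ c, γ.app c ≫ i = δ.app c ≫ k) : γ = δ := by
  have key : ∀ {γ δ : NCone C} (i : γ.vertex ⟶ b) (k : δ.vertex ⟶ b), IsIncl i → IsIncl k →
      (∀ c, γ.app c ≫ i = δ.app c ≫ k) → ∃ l : γ.vertex ⟶ δ.vertex, IsIncl l := by
    intro γ δ i k hi hk h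
    obtain ⟨c, hc⟩ := γ.exists_iso
    refine ⟨inv (γ.app c) ≫ δ.app c, CategoryWithSubobjects.incl_of_comp _ k ?_ hk⟩
    have : (inv (γ.app c) ≫ δ.app c) ≫ k = i := by
      rw [Category.assoc, ← h]; simp
    rw [this]; exact hi
  obtain ⟨l, hl⟩ := key i k hi hk h
  obtain ⟨l', hl'⟩ := key k i hk hi (fun c => (h c).symm)
  have e := CategoryWithSubobjects.incl_antisymm l l' hl hl'
  obtain ⟨z, γa, γc, γi⟩ := γ
  obtain ⟨z', δa, δc, δi⟩ := δ
  dsimp only at *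
  subst e
  obtain rfl := CategoryWithSubobjects.incl_unique _ _ hi hk
  have := hi.mono
  have : γa = δa := funext fun c => (cancel_mono i).1 (h c)
  subst this
  rfl

/-- The inclusion of the vertex of a product into the vertex of the second factor. -/
noncomputable def mulIncl [NormalCategory C] (γ δ : NCone C) :
    (γ * δ).vertex ⟶ δ.vertex := imIncl (δ.app γ.vertex)

theorem isIncl_mulIncl [NormalCategory C] (γ δ : NCone C) : IsIncl (mulIncl γ δ) :=
  (canonicalFactorisation_spec (δ.app γ.vertex)).2.1

theorem mul_app [NormalCategory C] (γ δ : NCone C) (c : C) :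
    (γ * δ).app c ≫ mulIncl γ δ = γ.app c ≫ δ.app γ.vertex := by
  change (γ.app c ≫ epiPart _) ≫ imIncl _ = _
  rw [Category.assoc, ← (canonicalFactorisation_spec (δ.app γ.vertex)).2.2]

/-- Characterisation of the product of cones. -/
theorem eq_mul [NormalCategory C] {γ δ σ : NCone C} (i : σ.vertex ⟶ δ.vertex) (hi : IsIncl i)
    (h : ∀ c, σ.app c ≫ i = γ.app c ≫ δ.app γ.vertex) : σ = γ * δ :=
  eq_of_incl i (mulIncl γ δ) hi (isIncl_mulIncl γ δ) fun c => by rw [h, mul_app]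

noncomputable instance [NormalCategory C] : Semigroup (NCone C) where
  mul_assoc γ δ σ := by
    refine eq_of_incl (mulIncl (γ * δ) σ) (mulIncl γ (δ * σ) ≫ mulIncl δ σ)
      (isIncl_mulIncl _ _) (CategoryWithSubobjects.incl_comp _ _ (isIncl_mulIncl _ _)
        (isIncl_mulIncl _ _)) fun c => ?_
    have h : (γ * (δ * σ)).app c ≫ mulIncl γ (δ * σ) ≫ mulIncl δ σ =
        γ.app c ≫ δ.app γ.vertex ≫ σ.app δ.vertex := by
      rw [← Category.assoc, mul_app, Category.assoc, mul_app]
    rw [h, mul_app, ← σ.compat _ (isIncl_mulIncl γ δ), ← Category.assoc, mul_app,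
      Category.assoc]

theorem idem_of_app [NormalCategory C] {μ : NCone C} (h : μ.app μ.vertex = 𝟙 μ.vertex) :
    IsIdempotentElem μ :=
  (eq_mul (𝟙 _) (CategoryWithSubobjects.incl_id _) fun c => by rw [h]).symm

theorem app_vertex_of_idem [NormalCategory C] {μ : NCone C} (h : IsIdempotentElem μ) :
    μ.app μ.vertex = 𝟙 μ.vertex := by
  obtain ⟨c, hc⟩ := μ.exists_iso
  have hv : ∀ ν : NCone C, ν = μ → ∀ i : ν.vertex ⟶ μ.vertex, IsIncl i →
      ν.app c ≫ i = μ.app c := by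
    rintro ν rfl i hi
    obtain rfl := CategoryWithSubobjects.incl_unique _ _ hi (CategoryWithSubobjects.incl_id _)
    simp
  have := hv _ h _ (isIncl_mulIncl μ μ)
  rw [mul_app] at this
  rw [← cancel_epi (μ.app c), this]; simp

theorem mul_app_of_eq [NormalCategory C] {γ δ σ : NCone C} (h : σ = γ * δ) :
    ∃ i : σ.vertex ⟶ δ.vertex, IsIncl i ∧ ∀ c, σ.app c ≫ i = γ.app c ≫ δ.app γ.vertex := by
  subst h
  exact ⟨mulIncl γ δ, isIncl_mulIncl γ δ, mul_app γ δ⟩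

theorem isIncl_eqToHom {a b : C} (h : a = b) : IsIncl (eqToHom h) := by
  subst h
  exact CategoryWithSubobjects.incl_id _

theorem isIncl_self {a : C} {i : a ⟶ a} (h : IsIncl i) : i = 𝟙 a :=
  CategoryWithSubobjects.incl_unique _ _ h (CategoryWithSubobjects.incl_id _)

/-- If `f` followed by an inclusion `i` is an isomorphism, so are `i` and `f`. -/
theorem isIso_of_comp_incl {a b c : C} (f : a ⟶ b) (i : b ⟶ c) (hi : IsIncl i)
    (h : IsIso (f ≫ i)) : IsIso f := by
  have := hi.mono
  have h1 : i ≫ (inv (f ≫ i) ≫ f) = 𝟙 b := by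
    rw [← cancel_mono i]; simp
  have : IsIso i := ⟨inv (f ≫ i) ≫ f, h1, by simp⟩
  exact IsIso.of_isIso_comp_right f i

theorem app_eq_eqToHom [NormalCategory C] {μ : NCone C} (h : IsIdempotentElem μ) {z : C}
    (hz : μ.vertex = z) : μ.app z = eqToHom hz.symm := by
  subst hz
  exact app_vertex_of_idem h

theorem rle_app [NormalCategory C] {σ ρ : NCone C} (h : RLe σ ρ) :
    ∃ f : ρ.vertex ⟶ σ.vertex, ∀ c, σ.app c = ρ.app c ≫ f := by
  obtain ⟨x, h⟩ := h
  obtain ⟨i, hi, h⟩ := mul_app_of_eq h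
  obtain ⟨r, hr⟩ := NormalCategory.incl_split i hi
  refine ⟨x.app ρ.vertex ≫ r, fun c => ?_⟩
  rw [← Category.assoc, ← h, Category.assoc, hr, Category.comp_id]

theorem eq_of_rle [NormalCategory C] {σ τ ρ : NCone C} (hσ : RLe σ ρ) (hτ : RLe τ ρ) {a : C}
    (ha : IsIso (ρ.app a)) {b : C} (i : σ.vertex ⟶ b) (k : τ.vertex ⟶ b) (hi : IsIncl i)
    (hk : IsIncl k) (h : σ.app a ≫ i = τ.app a ≫ k) : σ = τ := by
  obtain ⟨f, hf⟩ := rle_app hσ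
  obtain ⟨g, hg⟩ := rle_app hτ
  refine eq_of_incl i k hi hk fun c => ?_
  have : f ≫ i = g ≫ k := by
    rw [← cancel_epi (ρ.app a), ← Category.assoc, ← hf, h, hg, Category.assoc]
  rw [hf, hg, Category.assoc, this, Category.assoc]

/-- An idempotent cone is determined by its vertex and its `R`-class. -/
theorem idem_unique [NormalCategory C] {ε ε' : NCone C} (h : IsIdempotentElem ε)
    (h' : IsIdempotentElem ε') (hR : RLe ε ε') (hv : ε.vertex = ε'.vertex) : ε = ε' := by
  obtain ⟨f, hf⟩ := rle_app hR
  refine eq_of_incl (𝟙 _) (eqToHom hv.symm) (isIncl_eqToHom rfl) (isIncl_eqToHom _) fun c => ?_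
  have : f = eqToHom hv.symm := by
    have := hf ε'.vertex
    rw [app_vertex_of_idem h', Category.id_comp] at this
    rw [← this, app_eq_eqToHom h hv]
  rw [hf, this, Category.comp_id]

/-- `γ * f` is the product of `γ` with any cone whose component at the vertex of `γ` is `f`. -/
theorem star_eq_mul [NormalCategory C] (γ δ : NCone C) (f : γ.vertex ⟶ δ.vertex) (hf : Epi f)
    (h : δ.app γ.vertex = f) : γ.star f hf = γ * δ :=
  eq_mul (σ := γ.star f hf) (𝟙 _) (isIncl_eqToHom rfl) fun c => by
    rw [h]; exact Category.comp_id _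

theorem star_rle [NormalCategory C] {ε : NCone C} (hε : IsIdempotentElem ε) {z : C}
    (f : ε.vertex ⟶ z) (hf : Epi f) : RLe (ε.star f hf) ε :=
  ⟨ε.star f hf, star_eq_mul ε (ε.star f hf) f hf (by
    change ε.app ε.vertex ≫ f = f
    rw [app_vertex_of_idem hε, Category.id_comp])⟩

theorem exists_idem [NormalCategory C] (z : C) :
    ∃ ν : NCone C, IsIdempotentElem ν ∧ ν.vertex = z := by
  obtain ⟨μ, hμ, hμ'⟩ := NormalCategory.exists_cone z
  exact ⟨μ, idem_of_app hμ', hμ⟩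

/-- Inverses in the semigroup of cones, with control of the `R`-class. -/
theorem exists_inverse_rle [NormalCategory C] (γ ε : NCone C) (hε : IsIdempotentElem ε)
    (hv : ε.vertex = γ.vertex) :
    ∃ χ, RLe χ ε ∧ γ * χ * γ = γ ∧ χ * γ * χ = χ := by
  obtain ⟨d, hd⟩ := γ.exists_iso
  obtain ⟨χ, hr, h, hχγ⟩ : ∃ χ : NCone C, RLe χ ε ∧ ∃ h : χ.vertex = d,
      χ.app γ.vertex = inv (γ.app d) ≫ eqToHom h.symm := by
    refine ⟨ε.star (eqToHom hv ≫ inv (γ.app d)) inferInstance, star_rle hε _ _, rfl, ?_⟩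
    change ε.app _ ≫ _ = _
    rw [app_eq_eqToHom hε hv]
    simp only [eqToHom_trans_assoc, eqToHom_refl, Category.id_comp]
    exact (Category.comp_id _).symm
  subst h
  rw [eqToHom_refl, Category.comp_id] at hχγ
  refine ⟨χ, hr, ?_, ?_⟩
  · refine (eq_mul (𝟙 _) (isIncl_eqToHom rfl) fun c => ?_).symm
    rw [← γ.compat _ (isIncl_mulIncl γ χ), ← Category.assoc, mul_app, hχγ]; simp
  · refine (eq_mul (𝟙 _) (isIncl_eqToHom rfl) fun c => ?_).symm
    rw [← χ.compat _ (isIncl_mulIncl χ γ), ← Category.assoc, mul_app, hχγ]; simp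

instance [NormalCategory C] : RegularSemigroup (NCone C) where
  exists_inverse γ := by
    obtain ⟨ε, hε, hv⟩ := exists_idem γ.vertex
    obtain ⟨χ, -, h, h'⟩ := exists_inverse_rle γ ε hε hv
    exact ⟨χ, h, h'⟩

/-- Multiplying by an isomorphism does not change the `R`-class. -/
theorem of_star [NormalCategory C] {ε : NCone C} (hε : IsIdempotentElem ε) {z : C}
    (u : ε.vertex ⟶ z) (hu : IsIso u) : RClass.of (ε.star u inferInstance) = RClass.of ε := by
  refine le_antisymm (star_rle hε u _) ?_
  obtain ⟨ν, hν, hv⟩ := exists_idem z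
  subst hv
  refine ⟨ν.star (inv u) inferInstance, ?_⟩
  refine eq_mul (𝟙 _) (isIncl_eqToHom rfl) fun c => ?_
  change ε.app c ≫ 𝟙 _ = (ε.app c ≫ u) ≫ ν.app ν.vertex ≫ inv u
  rw [app_vertex_of_idem hν]; simp

/-- Every cone is `ε * u` for an idempotent cone `ε` in its `R`-class and an isomorphism `u`. -/
theorem exists_eq_star [NormalCategory C] (γ : NCone C) :
    ∃ (ε : NCone C) (u : ε.vertex ⟶ γ.vertex) (_ : IsIso u), IsIdempotentElem ε ∧
      RClass.of ε = RClass.of γ ∧ γ = ε.star u inferInstance := by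
  obtain ⟨x, hx, -⟩ := RegularSemigroup.exists_inverse γ
  have hε : IsIdempotentElem (γ * x) := by
    change γ * x * (γ * x) = γ * x
    rw [← mul_assoc, hx]
  have h1 : RLe γ (γ * x) := ⟨γ, hx.symm⟩
  have h2 : RLe (γ * x) γ := ⟨x, rfl⟩
  generalize γ * x = ε at *
  obtain ⟨f, hf⟩ := rle_app h1
  obtain ⟨g, hg⟩ := rle_app h2
  obtain ⟨d, hd⟩ := ε.exists_iso
  obtain ⟨d', hd'⟩ := γ.exists_iso
  have hfg : f ≫ g = 𝟙 _ := by
    rw [← cancel_epi (ε.app d), ← Category.assoc, ← hf, ← hg, Category.comp_id]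
  have hgf : g ≫ f = 𝟙 _ := by
    rw [← cancel_epi (γ.app d'), ← Category.assoc, ← hg, ← hf, Category.comp_id]
  refine ⟨ε, f, ⟨g, hfg, hgf⟩, hε, le_antisymm h2 h1, ?_⟩
  exact eq_of_incl (δ := ε.star f _) (𝟙 _) (𝟙 _) (isIncl_eqToHom rfl) (isIncl_eqToHom rfl)
    fun c => by rw [hf]; rfl

end NCone

/-- The object `c` is connected by the `R`-class `d` if `d` contains an idempotent cone with
vertex `c`. -/
def ConnectedBy [NormalCategory C] (c : C) (d : RClass (NCone C)) : Prop :=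
  ∃ ε : NCone C, IsIdempotentElem ε ∧ ε.vertex = c ∧ RClass.of ε = d

end Normal

/-! ### The category of connected categories -/

/-- A connected category: a normal category `C` with a down-set `D` of the poset of
`R`-classes of the semigroup of cones in `C`, such that each object of `C` is connected by some
member of `D`. -/
structure CC : Type (u + 1) where
  carrier : Type u
  [cat : SmallCategory carrier]
  [sub : CategoryWithSubobjects carrier]
  [normal : NormalCategory carrier]
  D : LowerSet (RClass (NCone carrier))
  connected : ∀ c : carrier, ∃ d ∈ D, ConnectedBy c d

attribute [instance] CC.cat CC.sub CC.normal

namespace CC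

/-- A CC-morphism `(F, G)`. The last two fields say that if `c` is connected by `d` then `F c`
is connected by `G d`, and that `F` maps the components of the idempotent cone `ε(c, d)` to
those of the idempotent cone `ε(F c, G d)`. -/
@[ext]
structure Hom (X Y : CC.{u}) where
  F : X.carrier ⥤ Y.carrier
  map_incl : ∀ {a b : X.carrier} (j : a ⟶ b), IsIncl j → IsIncl (F.map j)
  G : X.D →o Y.D
  map_connected : ∀ (c : X.carrier) (d : X.D),
    ConnectedBy c d.1 → ConnectedBy (F.obj c) (G d).1
  map_app : ∀ (d : X.D) (ε : NCone X.carrier) (ε' : NCone Y.carrier),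
    IsIdempotentElem ε → RClass.of ε = d.1 → IsIdempotentElem ε' → RClass.of ε' = (G d).1 →
    ∀ (hv : ε'.vertex = F.obj ε.vertex) (c : X.carrier),
      F.map (ε.app c) ≫ eqToHom hv.symm = ε'.app (F.obj c)

/-- Connected categories and CC-morphisms form a category. -/
noncomputable instance : Category CC.{u} where
  Hom := Hom
  id X :=
    { F := 𝟭 _
      map_incl := fun _ hj => hj
      G := OrderHom.id
      map_connected := fun _ _ h => h
      map_app := fun d ε ε' h hd h' hd' hv c => by
        obtain rfl := NCone.idem_unique h' h
          (RClass.of_le_of.1 (le_of_eq (hd'.trans hd.symm))) hv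
        simp }
  comp {X Y Z} m n :=
    { F := m.F ⋙ n.F
      map_incl := fun j hj => n.map_incl _ (m.map_incl j hj)
      G := n.G.comp m.G
      map_connected := fun c d h => n.map_connected _ _ (m.map_connected c d h)
      map_app := fun d ε ε' h hd h' hd' hv c => by
        obtain ⟨ε₁, h₁, hv₁, hd₁⟩ := m.map_connected ε.vertex d ⟨ε, h, rfl, hd⟩
        have e₁ := m.map_app d ε ε₁ h hd h₁ hd₁ hv₁ c
        have e₂ := n.map_app _ ε₁ ε' h₁ hd₁ h' hd' (hv.trans (by rw [hv₁]; rfl)) (m.F.obj c)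
        rw [← e₁] at e₂
        simp only [Functor.map_comp, eqToHom_map, Category.assoc, eqToHom_trans] at e₂
        exact e₂ }

/-! ### The connection semigroup -/

/-- The connection semigroup: the cones whose `R`-class lies in `D`, as a subsemigroup of the
semigroup of all cones. -/
noncomputable def connSemigroup (X : CC.{u}) : Subsemigroup (NCone X.carrier) where
  carrier := {γ | RClass.of γ ∈ X.D}
  mul_mem' {_ δ} hγ _ := X.D.lower (RClass.of_le_of.2 ⟨δ, rfl⟩) hγ

instance (X : CC.{u}) : RegularSemigroup X.connSemigroup where
  exists_inverse := by
    rintro ⟨γ, hγ⟩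
    obtain ⟨d, hd, ε, hε, hv, rfl⟩ := X.connected γ.vertex
    obtain ⟨χ, hχ, h, h'⟩ := NCone.exists_inverse_rle γ ε hε hv
    exact ⟨⟨χ, X.D.lower (RClass.of_le_of.2 hχ) hd⟩, Subtype.ext h, Subtype.ext h'⟩

/-- The dual connection semigroup: the opposite of the connection semigroup. -/
abbrev dualConnSemigroup (X : CC.{u}) : Type u := (X.connSemigroup)ᵐᵒᵖ

instance (X : CC.{u}) : RegularSemigroup X.dualConnSemigroup where
  exists_inverse a := by
    obtain ⟨x, h, h'⟩ := RegularSemigroup.exists_inverse a.unop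
    refine ⟨MulOpposite.op x, MulOpposite.unop_injective ?_, MulOpposite.unop_injective ?_⟩
    · simpa [mul_assoc] using h
    · simpa [mul_assoc] using h'

instance (X : CC.{u}) : RightReductive X.dualConnSemigroup where
  injective := by
    intro a b hab
    have hl : ∀ γ₁ γ₂ : X.connSemigroup, (∀ γ, γ * γ₁ = γ * γ₂) →
        ∃ i : γ₁.1.vertex ⟶ γ₂.1.vertex, IsIncl i := by
      intro γ₁ γ₂ h
      obtain ⟨x, hx, -⟩ := RegularSemigroup.exists_inverse γ₁
      have := h (γ₁ * x)
      rw [hx] at this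
      obtain ⟨i, hi, -⟩ := NCone.mul_app_of_eq (congrArg Subtype.val this)
      exact ⟨i, hi⟩
    have h : ∀ γ, γ * a.unop = γ * b.unop := fun γ => by
      have := congrArg MulOpposite.unop (congrFun hab (MulOpposite.op γ))
      simpa using this
    obtain ⟨i, hi⟩ := hl _ _ h
    refine MulOpposite.unop_injective (Subtype.ext ?_)
    refine NCone.eq_of_incl i (𝟙 _) hi (NCone.isIncl_eqToHom rfl) fun c => ?_
    obtain ⟨d, hd, ε, hε, rfl, rfl⟩ := X.connected c
    obtain ⟨j₁, hj₁, e₁⟩ := NCone.mul_app_of_eq (rfl : ε * a.unop.1 = _)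
    obtain ⟨j₂, hj₂, e₂⟩ := NCone.mul_app_of_eq
      (congrArg Subtype.val (h ⟨ε, hd⟩) : ε * a.unop.1 = ε * b.unop.1)
    have e : j₁ ≫ i = j₂ := CategoryWithSubobjects.incl_unique _ _
      (CategoryWithSubobjects.incl_comp _ _ hj₁ hi) hj₂
    have e₁ := e₁ ε.vertex
    have e₂ := e₂ ε.vertex
    rw [NCone.app_vertex_of_idem hε, Category.id_comp] at e₁ e₂
    rw [← e₁, Category.assoc, e, Category.comp_id]
    exact e₂

/-- `γ` has the form `ε(c, d) * u` with `u` an isomorphism, and `γ'` is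
`ε(F c, G d) * F u`. -/
def Hom.IsImage {X Y : CC.{u}} (m : X.Hom Y) (γ : NCone X.carrier) (γ' : NCone Y.carrier) :
    Prop :=
  ∃ (d : X.D) (ε : NCone X.carrier) (ε' : NCone Y.carrier) (z : X.carrier)
    (u : ε.vertex ⟶ z) (_ : IsIso u) (hv : ε'.vertex = m.F.obj ε.vertex),
    IsIdempotentElem ε ∧ RClass.of ε = d.1 ∧ IsIdempotentElem ε' ∧ RClass.of ε' = (m.G d).1 ∧
    γ = ε.star u inferInstance ∧ γ' = ε'.star (eqToHom hv ≫ m.F.map u) inferInstance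

theorem Hom.exists_isImage {X Y : CC.{u}} (m : X.Hom Y) (γ : X.connSemigroup) :
    ∃ γ', m.IsImage γ.1 γ' := by
  obtain ⟨γ, hγ⟩ := γ
  obtain ⟨ε, u, hu, hε, hR, e⟩ := γ.exists_eq_star
  obtain ⟨ε', hε', hv, hd⟩ := m.map_connected ε.vertex ⟨_, hγ⟩ ⟨ε, hε, rfl, hR⟩
  exact ⟨_, ⟨_, hγ⟩, ε, ε', _, u, hu, hv, hε, hR, hε', hd, e, rfl⟩

theorem Hom.IsImage.spec {X Y : CC.{u}} {m : X.Hom Y} {γ : NCone X.carrier}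
    {γ' : NCone Y.carrier} (h : m.IsImage γ γ') (hγ : RClass.of γ ∈ X.D) :
    RClass.of γ' = (m.G ⟨RClass.of γ, hγ⟩).1 ∧
    ∃ i : γ'.vertex ⟶ m.F.obj γ.vertex, IsIncl i ∧
      ∀ c, γ'.app (m.F.obj c) ≫ i = m.F.map (γ.app c) := by
  obtain ⟨d, ε, ε', z, u, hu, hv, hε, hd, hε', hd', rfl, rfl⟩ := h
  have e := NCone.of_star hε u hu
  refine ⟨?_, 𝟙 _, NCone.isIncl_eqToHom rfl, fun c => ?_⟩
  · rw [NCone.of_star hε' _ inferInstance, hd']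
    congr 2
    exact Subtype.ext (hd.symm.trans e.symm)
  · have := m.map_app d ε ε' hε hd hε' hd' hv c
    change (ε'.app (m.F.obj c) ≫ eqToHom hv ≫ m.F.map u) ≫ 𝟙 _ = m.F.map (ε.app c ≫ u)
    rw [← this]; simp

theorem Hom.image_unique {X Y : CC.{u}} (m : X.Hom Y) {γ : NCone X.carrier}
    {σ τ : NCone Y.carrier} (hR : RClass.of σ = RClass.of τ)
    (hσ : ∃ i : σ.vertex ⟶ m.F.obj γ.vertex, IsIncl i ∧
      ∀ c, σ.app (m.F.obj c) ≫ i = m.F.map (γ.app c))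
    (hτ : ∃ i : τ.vertex ⟶ m.F.obj γ.vertex, IsIncl i ∧
      ∀ c, τ.app (m.F.obj c) ≫ i = m.F.map (γ.app c)) : σ = τ := by
  obtain ⟨i, hi, ei⟩ := hσ
  obtain ⟨k, hk, ek⟩ := hτ
  obtain ⟨c, hc⟩ := γ.exists_iso
  refine NCone.eq_of_rle (ρ := σ) (a := m.F.obj c) (RLe.refl σ)
    (RClass.of_le_of.1 hR.ge) ?_ i k hi hk ?_
  · exact NCone.isIso_of_comp_incl _ i hi (by rw [ei]; infer_instance)
  · rw [ei, ek]

/-- The map of connection semigroups induced by a CC-morphism `(F, G)`: it sends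
`ε(c, d) * u` to `ε(F c, G d) * F u`. -/
noncomputable def Hom.mapCone {X Y : CC.{u}} (m : X.Hom Y) (γ : X.connSemigroup) :
    Y.connSemigroup :=
  ⟨(m.exists_isImage γ).choose, by
    have := ((m.exists_isImage γ).choose_spec.spec γ.2).1
    change RClass.of _ ∈ Y.D
    rw [this]; exact (m.G _).2⟩

/-- The value of `mapCone` does not depend on the chosen representation `ε(c, d) * u`. -/
theorem Hom.mapCone_eq_iff {X Y : CC.{u}} (m : X.Hom Y) (γ : X.connSemigroup)
    (γ' : NCone Y.carrier) : (m.mapCone γ).1 = γ' ↔ m.IsImage γ.1 γ' := by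
  constructor
  · rintro rfl; exact (m.exists_isImage γ).choose_spec
  · intro h
    have h₁ := (m.exists_isImage γ).choose_spec.spec γ.2
    have h₂ := h.spec γ.2
    exact m.image_unique (h₁.1.trans h₂.1.symm) h₁.2 h₂.2

theorem Hom.mapCone_spec {X Y : CC.{u}} (m : X.Hom Y) (γ : X.connSemigroup) :
    RClass.of (m.mapCone γ).1 = (m.G ⟨RClass.of γ.1, γ.2⟩).1 ∧
    ∃ i : (m.mapCone γ).1.vertex ⟶ m.F.obj γ.1.vertex, IsIncl i ∧
      ∀ c, (m.mapCone γ).1.app (m.F.obj c) ≫ i = m.F.map (γ.1.app c) :=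
  ((m.mapCone_eq_iff γ _).1 rfl).spec γ.2

theorem Hom.mapCone_unique {X Y : CC.{u}} (m : X.Hom Y) (γ : X.connSemigroup)
    (τ : Y.connSemigroup) (h : RClass.of τ.1 = (m.G ⟨RClass.of γ.1, γ.2⟩).1)
    (h' : ∃ i : τ.1.vertex ⟶ m.F.obj γ.1.vertex, IsIncl i ∧
      ∀ c, τ.1.app (m.F.obj c) ≫ i = m.F.map (γ.1.app c)) : m.mapCone γ = τ :=
  Subtype.ext (m.image_unique ((m.mapCone_spec γ).1.trans h.symm) (m.mapCone_spec γ).2 h')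

theorem Hom.mapCone_mul {X Y : CC.{u}} (m : X.Hom Y) (γ δ : X.connSemigroup) :
    m.mapCone (γ * δ) = m.mapCone γ * m.mapCone δ := by
  obtain ⟨hγ, i, hi, ei⟩ := m.mapCone_spec γ
  obtain ⟨-, k, hk, ek⟩ := m.mapCone_spec δ
  obtain ⟨hγδ, l, hl, el⟩ := m.mapCone_spec (γ * δ)
  obtain ⟨c, hc⟩ := γ.1.exists_iso
  refine Subtype.ext (NCone.eq_of_rle (ρ := (m.mapCone γ).1) (a := m.F.obj c)
    (b := m.F.obj δ.1.vertex) ?_ ⟨_, rfl⟩ ?_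
    (l ≫ m.F.map (NCone.mulIncl γ.1 δ.1)) (NCone.mulIncl _ (m.mapCone δ).1 ≫ k) ?_ ?_ ?_)
  · rw [← RClass.of_le_of, hγ, hγδ]
    exact m.G.monotone (a := ⟨_, (γ * δ).2⟩) (b := ⟨_, γ.2⟩)
      (RClass.of_le_of.2 ⟨δ.1, rfl⟩)
  · exact NCone.isIso_of_comp_incl _ i hi (by rw [ei]; infer_instance)
  · exact CategoryWithSubobjects.incl_comp _ _ hl (m.map_incl _ (NCone.isIncl_mulIncl _ _))
  · exact CategoryWithSubobjects.incl_comp _ _ (NCone.isIncl_mulIncl _ _) hk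
  · have h₁ : m.F.map ((γ * δ).1.app c) ≫ m.F.map (NCone.mulIncl γ.1 δ.1) =
        m.F.map (γ.1.app c) ≫ m.F.map (δ.1.app γ.1.vertex) := by
      rw [← Functor.map_comp, ← Functor.map_comp]
      exact congrArg m.F.map (NCone.mul_app γ.1 δ.1 c)
    have h₂ : (m.mapCone γ * m.mapCone δ).1.app (m.F.obj c) ≫
        NCone.mulIncl (m.mapCone γ).1 (m.mapCone δ).1 =
        (m.mapCone γ).1.app (m.F.obj c) ≫ (m.mapCone δ).1.app (m.mapCone γ).1.vertex :=
      NCone.mul_app _ _ _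
    rw [← Category.assoc, el, h₁]
    refine Eq.trans ?_ (Category.assoc _ _ _)
    rw [h₂, ← (m.mapCone δ).1.compat i hi, Category.assoc, Category.assoc, ek,
      ← Category.assoc, ei]

end CC

/-! ### The category of right reductive regular semigroups -/

/-- The property of being a right reductive regular semigroup. -/
def isRRS : ObjectProperty Semigrp.{u} := fun S => RegularSemigroup S ∧ RightReductive S

/-- The category of right reductive regular semigroups and semigroup homomorphisms, as a full
subcategory of the category of semigroups. -/
abbrev RRS : Type (u + 1) := (isRRS.{u}).FullSubcategory

instance (S : RRS.{u}) : RegularSemigroup S.obj := S.property.1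
instance (S : RRS.{u}) : RightReductive S.obj := S.property.2

/-- The functor from connected categories to right reductive regular semigroups: it sends a
connected category to its dual connection semigroup. -/
noncomputable def CC.toRRS : CC.{u} ⥤ RRS.{u} where
  obj X := ⟨Semigrp.of X.dualConnSemigroup, ⟨inferInstance, inferInstance⟩⟩
  map {X Y} m := ObjectProperty.homMk (Semigrp.ofHom
    { toFun := fun γ => MulOpposite.op (CC.Hom.mapCone m γ.unop)
      map_mul' := fun γ δ => by
        rw [MulOpposite.unop_mul, CC.Hom.mapCone_mul, MulOpposite.op_mul] })
  map_id X := by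
    ext γ
    refine congrArg MulOpposite.op (CC.Hom.mapCone_unique _ γ.unop γ.unop rfl ?_)
    exact ⟨𝟙 _, NCone.isIncl_eqToHom rfl, fun c => Category.comp_id _⟩
  map_comp {X Y Z} m n := by
    ext γ
    refine congrArg MulOpposite.op (CC.Hom.mapCone_unique _ γ.unop
      (CC.Hom.mapCone n (CC.Hom.mapCone m γ.unop)) ?_ ?_)
    · obtain ⟨h, -⟩ := CC.Hom.mapCone_spec m γ.unop
      obtain ⟨h', -⟩ := CC.Hom.mapCone_spec n (CC.Hom.mapCone m γ.unop)
      rw [h']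
      exact congrArg (fun d => (CC.Hom.G n d).1) (Subtype.ext h)
    · obtain ⟨-, i, hi, e⟩ := CC.Hom.mapCone_spec m γ.unop
      obtain ⟨-, i', hi', e'⟩ := CC.Hom.mapCone_spec n (CC.Hom.mapCone m γ.unop)
      refine ⟨i' ≫ (CC.Hom.F n).map i, CategoryWithSubobjects.incl_comp _ _ hi'
        (CC.Hom.map_incl n _ hi), fun c => ?_⟩
      have e'' := e' ((CC.Hom.F m).obj c)
      rw [← Category.assoc]
      refine (congrArg (· ≫ (CC.Hom.F n).map i) e'').trans ?_
      rw [← Functor.map_comp, e]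
      rfl

/-! ### The category of principal right ideals -/

section RightCategory

/-- The objects of the right category of `S`: the principal right ideals `e S` with `e`
idempotent. -/
@[ext]
structure RCat (S : Type u) [Semigroup S] : Type u where
  ideal : Set S
  exists_eq : ∃ e : S, IsIdempotentElem e ∧ ideal = {y | ∃ s, y = e * s}

namespace RCat

variable {S : Type u} [Semigroup S]

/-- The morphisms `e S ⟶ f S`: the maps `l(e, u, f)`, sending `x` to `u x`, with
`u ∈ f S e`. -/
@[ext]
structure Hom (X Y : RCat S) where
  toFun : X.ideal → Y.ideal
  exists_eq : ∃ e f u : S, IsIdempotentElem e ∧ X.ideal = {y | ∃ s, y = e * s} ∧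
    IsIdempotentElem f ∧ Y.ideal = {y | ∃ s, y = f * s} ∧ (∃ s, u = f * s * e) ∧
    ∀ x, (toFun x : S) = u * x

theorem mul_mem (X : RCat S) {x : S} (hx : x ∈ X.ideal) (s : S) : x * s ∈ X.ideal := by
  obtain ⟨X, e, he, rfl⟩ := X
  obtain ⟨t, rfl⟩ := hx
  exact ⟨t * s, mul_assoc _ _ _⟩

/-- Left multiplication by `u` as a morphism `X ⟶ Y`, if it maps `X` to `Y`. -/
def lmul {X Y : RCat S} (u : S) (h : ∀ x ∈ X.ideal, u * x ∈ Y.ideal) : Hom X Y where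
  toFun x := ⟨u * x, h x x.2⟩
  exists_eq := by
    obtain ⟨X, e, he, rfl⟩ := X
    obtain ⟨Y, f, hf, rfl⟩ := Y
    obtain ⟨t, ht⟩ := h e ⟨e, he.symm⟩
    refine ⟨e, f, u * e, he, rfl, hf, rfl, ⟨t, ?_⟩, ?_⟩
    · rw [← ht, mul_assoc, he]
    · rintro ⟨x, s, rfl⟩
      change u * (e * s) = u * e * (e * s)
      rw [mul_assoc u e, ← mul_assoc e e, he]

theorem Hom.exists_mul {X Y : RCat S} (f : Hom X Y) :
    ∃ u : S, ∀ x, (f.toFun x : S) = u * x := by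
  obtain ⟨e, g, u, -, -, -, -, -, h⟩ := f.exists_eq
  exact ⟨u, h⟩

/-- The right category of `S`; composition is composition of maps, written in the order of
application. -/
instance : SmallCategory (RCat S) where
  Hom := Hom
  id X :=
    { toFun := id
      exists_eq := by
        obtain ⟨X, e, he, rfl⟩ := X
        refine ⟨e, e, e, he, rfl, he, rfl, ⟨e, by rw [he, he]⟩, ?_⟩
        rintro ⟨x, s, rfl⟩
        change e * s = e * (e * s)
        rw [← mul_assoc, he] }
  comp {X Y Z} f g :=
    { toFun := g.toFun ∘ f.toFun
      exists_eq := by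
        obtain ⟨u, hu⟩ := f.exists_mul
        obtain ⟨v, hv⟩ := g.exists_mul
        have h : ∀ x : X.ideal, ((g.toFun (f.toFun x)) : S) = v * u * x := fun x => by
          rw [hv, hu, mul_assoc]
        obtain ⟨e, e', w, he, hX, he', hY, hw, h'⟩ :=
          (lmul (X := X) (Y := Z) (v * u) (fun x hx => by
            rw [← h ⟨x, hx⟩]; exact Subtype.prop _)).exists_eq
        exact ⟨e, e', w, he, hX, he', hY, hw, fun x => (h x).trans (h' x)⟩ }

/-- The action of a morphism on an element. -/
def ap {X Y : RCat S} (f : X ⟶ Y) : X.ideal → Y.ideal := Hom.toFun f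

theorem hom_ext {X Y : RCat S} {f g : X ⟶ Y} (h : ∀ x, (ap f x : S) = ap g x) : f = g :=
  Hom.ext (funext fun x => Subtype.ext (h x))

theorem ap_id {X : RCat S} (x : X.ideal) : ap (𝟙 X) x = x := rfl

theorem ap_comp {X Y Z : RCat S} (f : X ⟶ Y) (g : Y ⟶ Z) (x : X.ideal) :
    ap (f ≫ g) x = ap g (ap f x) := rfl

/-- Left multiplication by `u`, as a morphism. -/
def mulHom {X Y : RCat S} (u : S) (h : ∀ x ∈ X.ideal, u * x ∈ Y.ideal) : X ⟶ Y := lmul u h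

theorem ap_mulHom {X Y : RCat S} (u : S) (h : ∀ x ∈ X.ideal, u * x ∈ Y.ideal) (x : X.ideal) :
    (ap (mulHom u h) x : S) = u * x := rfl

theorem exists_mul {X Y : RCat S} (f : X ⟶ Y) : ∃ u : S, ∀ x, (ap f x : S) = u * x :=
  Hom.exists_mul f

theorem exists_idem (X : RCat S) :
    ∃ e : S, IsIdempotentElem e ∧ e ∈ X.ideal ∧ ∀ x ∈ X.ideal, e * x = x := by
  obtain ⟨X, e, he, rfl⟩ := X
  refine ⟨e, he, ⟨e, he.symm⟩, ?_⟩
  rintro _ ⟨s, rfl⟩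
  rw [← mul_assoc, he]

/-- The inclusions of the right category are the inclusion maps of principal right ideals. -/
instance : CategoryWithSubobjects (RCat S) where
  incl := fun _ _ f => ∀ x, (ap f x : S) = x
  incl_id _ _ := rfl
  incl_comp f g hf hg x := by rw [ap_comp, hg, hf]
  incl_unique f g hf hg := hom_ext fun x => by rw [hf, hg]
  incl_antisymm f g hf hg := RCat.ext (Set.Subset.antisymm
    (fun x hx => by have := (ap f ⟨x, hx⟩).2; rwa [hf] at this)
    (fun x hx => by have := (ap g ⟨x, hx⟩).2; rwa [hg] at this))
  incl_mono f hf := ⟨fun g h e => hom_ext fun x => by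
    have := congrArg (fun k => (ap k x : S)) e
    simpa only [ap_comp, hf] using this⟩
  incl_of_comp h g hc hg x := by rw [← hg, ← ap_comp, hc]

/-- The inclusion map of a principal right ideal into a larger one. -/
noncomputable def inclHom {X Y : RCat S} (h : X.ideal ⊆ Y.ideal) : X ⟶ Y :=
  mulHom (exists_idem X).choose fun x hx => by
    rw [(exists_idem X).choose_spec.2.2 x hx]; exact h hx

theorem ap_inclHom {X Y : RCat S} (h : X.ideal ⊆ Y.ideal) (x : X.ideal) : (ap (inclHom h) x : S) = x :=
  (exists_idem X).choose_spec.2.2 x x.2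

theorem isIso_of {X Y : RCat S} (f : X ⟶ Y) (g : Y ⟶ X) (h : ∀ x, (ap g (ap f x) : S) = x)
    (h' : ∀ y, (ap f (ap g y) : S) = y) : IsIso f :=
  ⟨g, hom_ext h, hom_ext h'⟩

theorem ap_eqToHom {X Y : RCat S} (h : X = Y) (x : X.ideal) : (ap (eqToHom h) x : S) = x := by
  subst h
  rfl

variable {S' S'' : Type u} [Semigroup S'] [Semigroup S'']


/-- The object map of the functor induced by a homomorphism `φ`: it sends `e S` to
`φ(e) S'`. -/
def mapObj (φ : S →ₙ* S') (X : RCat S) : RCat S' :=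
  ⟨{y | ∃ x ∈ X.ideal, ∃ s, y = φ x * s}, by
    obtain ⟨e, he, heX, h⟩ := exists_idem X
    refine ⟨φ e, he.map φ, Set.ext fun y => ⟨?_, ?_⟩⟩
    · rintro ⟨x, hx, s, rfl⟩
      exact ⟨φ x * s, by rw [← mul_assoc, ← map_mul, h x hx]⟩
    · rintro ⟨s, rfl⟩
      exact ⟨e, heX, s, rfl⟩⟩

theorem map_mul_mem (φ : S →ₙ* S') {X Y : RCat S} (f : X ⟶ Y) {u : S}
    (hu : ∀ x, (ap f x : S) = u * x) (y : S') (hy : y ∈ (mapObj φ X).ideal) :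
    φ u * y ∈ (mapObj φ Y).ideal := by
  obtain ⟨x, hx, s, rfl⟩ := hy
  refine ⟨u * x, ?_, s, by rw [map_mul, mul_assoc]⟩
  have := (ap f ⟨x, hx⟩).2
  rwa [hu] at this

/-- The functor induced by a homomorphism `φ`: it sends `l(e, u, f)` to
`l(φ e, φ u, φ f)`. -/
noncomputable def mapHom (φ : S →ₙ* S') {X Y : RCat S} (f : X ⟶ Y) :
    mapObj φ X ⟶ mapObj φ Y :=
  mulHom (φ (exists_mul f).choose) (map_mul_mem φ f (exists_mul f).choose_spec)

/-- The value of `mapHom` does not depend on the element `u` that represents the morphism. -/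
theorem ap_mapHom (φ : S →ₙ* S') {X Y : RCat S} (f : X ⟶ Y) {u : S}
    (hu : ∀ x, (ap f x : S) = u * x) (y : (mapObj φ X).ideal) :
    (ap (mapHom φ f) y : S') = φ u * y := by
  obtain ⟨_, x, hx, s, rfl⟩ := y
  change φ _ * (φ x * s) = φ u * (φ x * s)
  rw [← mul_assoc, ← mul_assoc, ← map_mul, ← map_mul,
    ← (exists_mul f).choose_spec ⟨x, hx⟩, ← hu ⟨x, hx⟩]

/-- The functor between right categories induced by a homomorphism. -/
noncomputable def mapFunctor (φ : S →ₙ* S') : RCat S ⥤ RCat S' where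
  obj := mapObj φ
  map := mapHom φ
  map_id X := hom_ext fun y => by
    obtain ⟨e, he, heX, h⟩ := exists_idem X
    obtain ⟨_, x, hx, s, rfl⟩ := y
    rw [ap_mapHom φ (𝟙 X) (u := e) fun x => by rw [ap_id, h x x.2], ap_id]
    change φ e * (φ x * s) = φ x * s
    rw [← mul_assoc, ← map_mul, h x hx]
  map_comp f g := hom_ext fun y => by
    obtain ⟨u, hu⟩ := exists_mul f
    obtain ⟨v, hv⟩ := exists_mul g
    rw [ap_comp, ap_mapHom φ g hv, ap_mapHom φ f hu,
      ap_mapHom φ (f ≫ g) (u := v * u) fun x => by rw [ap_comp, hv, hu, mul_assoc],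
      map_mul, mul_assoc]

theorem mapFunctor_id : mapFunctor (MulHom.id S) = 𝟭 (RCat S) := by
  refine CategoryTheory.Functor.ext (fun X => ?_) fun X Y f => ?_
  · refine RCat.ext (Set.ext fun y => ⟨?_, ?_⟩)
    · rintro ⟨x, hx, s, rfl⟩
      exact X.mul_mem hx s
    · intro hy
      obtain ⟨e, he, heX, h⟩ := X.exists_idem
      exact ⟨e, heX, y, (h y hy).symm⟩
  · obtain ⟨u, hu⟩ := exists_mul f
    refine hom_ext fun y => (ap_mapHom _ f hu y).trans ?_
    rw [ap_comp, ap_comp, ap_eqToHom]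
    refine Eq.trans ?_ (hu _).symm
    rw [ap_eqToHom]
    rfl

theorem mapFunctor_comp (φ : S →ₙ* S') (ψ : S' →ₙ* S'') :
    mapFunctor (ψ.comp φ) = mapFunctor φ ⋙ mapFunctor ψ := by
  refine CategoryTheory.Functor.ext (fun X => ?_) fun X Y f => ?_
  · refine RCat.ext (Set.ext fun y => ⟨?_, ?_⟩)
    · rintro ⟨x, hx, s, rfl⟩
      obtain ⟨e, he, heX, h⟩ := X.exists_idem
      refine ⟨φ e, ⟨e, heX, φ e, ?_⟩, ψ (φ x) * s, ?_⟩
      · rw [← map_mul, he]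
      · rw [← mul_assoc, ← map_mul, ← map_mul, h x hx]
        rfl
    · rintro ⟨_, ⟨x, hx, t, rfl⟩, s, rfl⟩
      refine ⟨x, hx, ψ t * s, ?_⟩
      rw [map_mul, mul_assoc]
      rfl
  · obtain ⟨u, hu⟩ := exists_mul f
    refine hom_ext fun y => (ap_mapHom _ f hu y).trans ?_
    rw [ap_comp, ap_comp, ap_eqToHom]
    refine Eq.trans ?_ (ap_mapHom ψ (mapHom φ f) (ap_mapHom φ f hu) _).symm
    rw [ap_eqToHom]
    rfl

variable [RegularSemigroup S]

/-- The principal right ideal `a S` of a regular semigroup; it equals `f S` for every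
idempotent `f` in the `R`-class of `a`. -/
def principal (a : S) : RCat S :=
  ⟨{y | ∃ s, y = a * s}, by
    obtain ⟨x, hx, -⟩ := RegularSemigroup.exists_inverse a
    refine ⟨a * x, ?_, ?_⟩
    · change a * x * (a * x) = a * x
      rw [← mul_assoc, hx]
    · ext y
      constructor
      · rintro ⟨s, rfl⟩
        exact ⟨a * s, by rw [← mul_assoc, hx]⟩
      · rintro ⟨s, rfl⟩
        exact ⟨x * s, mul_assoc _ _ _⟩⟩

theorem mem_principal (a : S) : a ∈ (principal a).ideal := by
  obtain ⟨x, hx, -⟩ := RegularSemigroup.exists_inverse a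
  exact ⟨x * a, by rw [← mul_assoc, hx]⟩

theorem mul_mem_principal (a s : S) : a * s ∈ (principal a).ideal := ⟨s, rfl⟩

theorem principal_subset {X : RCat S} {a : S} (h : a ∈ X.ideal) :
    (principal a).ideal ⊆ X.ideal := by
  rintro _ ⟨s, rfl⟩
  exact X.mul_mem h s

theorem eq_principal {X : RCat S} {e : S} (he : e ∈ X.ideal) (h : ∀ x ∈ X.ideal, e * x = x) :
    principal e = X :=
  RCat.ext (Set.Subset.antisymm (principal_subset he)
    fun x hx => ⟨x, (h x hx).symm⟩)

/-- The principal cone `l^a`: its vertex is `a S` and its component at `X = e S` is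
`x ↦ a x`, i.e. `l(e, a e, f)` for `f` an idempotent in the `R`-class of `a`. -/
def lcone (a : S) : NCone (RCat S) where
  vertex := principal a
  app X := mulHom a fun x _ => mul_mem_principal _ x
  compat j hj := hom_ext fun x => by
    rw [ap_comp, ap_mulHom, ap_mulHom, hj]
  exists_iso := by
    obtain ⟨x, hx, -⟩ := RegularSemigroup.exists_inverse a
    refine ⟨principal (x * a), isIso_of _ (mulHom x ?_) ?_ ?_⟩
    · rintro _ ⟨s, rfl⟩
      rw [← mul_assoc]
      exact mul_mem_principal _ s
    · rintro ⟨_, s, rfl⟩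
      rw [ap_mulHom, ap_mulHom]
      simp only [← mul_assoc]
      rw [mul_assoc x a x, mul_assoc x, hx]
    · rintro ⟨_, s, rfl⟩
      rw [ap_mulHom, ap_mulHom]
      simp only [← mul_assoc]
      rw [hx]

theorem ap_lcone (a : S) {X : RCat S} (x : X.ideal) : (ap ((lcone a).app X) x : S) = a * x := rfl

instance : NormalCategory (RCat S) where
  incl_split {X Y} j hj := by
    obtain ⟨e, he, heX, h⟩ := exists_idem X
    refine ⟨mulHom e fun y _ => X.mul_mem heX y, hom_ext fun x => ?_⟩
    rw [ap_comp, ap_mulHom, hj, h x x.2, ap_id]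
  exists_normalFactorisation {X Y} f := by
    obtain ⟨e, he, heX, h⟩ := exists_idem X
    obtain ⟨u', hu'⟩ := exists_mul f
    obtain ⟨u, hue, hu⟩ : ∃ u, u * e = u ∧ ∀ x, (ap f x : S) = u * x :=
      ⟨u' * e, by rw [mul_assoc, he], fun x => by rw [hu', mul_assoc, h x x.2]⟩
    have huY : u ∈ Y.ideal := by
      have := (ap f ⟨e, heX⟩).2
      rwa [hu, hue] at this
    obtain ⟨w, hw, -⟩ := RegularSemigroup.exists_inverse u
    have huew : u * (e * w * u) = u := by
      rw [← mul_assoc, ← mul_assoc, hue, hw]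
    have hgX : (principal (e * w * u)).ideal ⊆ X.ideal :=
      principal_subset (by rw [mul_assoc]; exact X.mul_mem heX _)
    have hg : ∀ s, e * w * u * (e * w * u * s) = e * w * u * s := fun s => by
      rw [← mul_assoc, mul_assoc (e * w) u, huew]
    refine ⟨principal (e * w * u), principal u, mulHom (e * w * u) (fun x _ => mul_mem_principal _ x),
      mulHom u (fun x _ => mul_mem_principal _ x), inclHom (principal_subset huY),
      ⟨inclHom hgX, ap_inclHom hgX, ?_⟩,
      isIso_of _ (mulHom (e * w) ?_) ?_ ?_, ap_inclHom _, ?_⟩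
    · refine hom_ext ?_
      rintro ⟨_, s, rfl⟩
      rw [ap_comp, ap_mulHom, ap_inclHom, ap_id, hg]
    · rintro _ ⟨s, rfl⟩
      rw [← mul_assoc]
      exact mul_mem_principal _ s
    · rintro ⟨_, s, rfl⟩
      rw [ap_mulHom, ap_mulHom, ← mul_assoc, hg]
    · rintro ⟨_, s, rfl⟩
      rw [ap_mulHom, ap_mulHom]
      rw [← mul_assoc (e * w) u s, ← mul_assoc, huew]
    · refine hom_ext fun x => ?_
      rw [ap_comp, ap_comp, ap_inclHom, ap_mulHom, ap_mulHom, hu, ← mul_assoc, huew]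
  exists_cone X := by
    obtain ⟨e, he, heX, h⟩ := exists_idem X
    have hX := eq_principal heX h
    subst hX
    refine ⟨lcone e, rfl, hom_ext fun x => ?_⟩
    rw [ap_lcone, ap_id]
    exact h x x.2

theorem lcone_mul (a b : S) : lcone a * lcone b = lcone (b * a) := by
  have h : (lcone (b * a)).vertex.ideal ⊆ (lcone b).vertex.ideal :=
    principal_subset (mul_mem_principal b a)
  refine (NCone.eq_mul (σ := lcone (b * a)) (inclHom h) (ap_inclHom h) fun X => ?_).symm
  refine hom_ext fun x => ?_
  rw [ap_comp, ap_inclHom, ap_comp, ap_lcone, ap_lcone, ap_lcone, mul_assoc]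

theorem lcone_idem {e : S} (he : IsIdempotentElem e) : IsIdempotentElem (lcone e) := by
  change lcone e * lcone e = lcone e
  rw [lcone_mul, he]

theorem eq_lcone_of_rle {γ : NCone (RCat S)} {a : S} (h : RLe γ (lcone a)) :
    ∃ u, γ = lcone (u * a) := by
  obtain ⟨δ, rfl⟩ := h
  obtain ⟨u, hu⟩ := exists_mul (δ.app (lcone a).vertex)
  have h : (lcone (u * a)).vertex.ideal ⊆ δ.vertex.ideal := by
    refine principal_subset ?_
    have := (ap (δ.app (lcone a).vertex) ⟨a, mem_principal a⟩).2
    rwa [hu] at this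
  refine ⟨u, (NCone.eq_mul (σ := lcone (u * a)) (inclHom h) (ap_inclHom h) fun X => ?_).symm⟩
  refine hom_ext fun x => ?_
  rw [ap_comp, ap_inclHom, ap_comp, ap_lcone, hu, ap_lcone, mul_assoc]

theorem lcone_rle_of_eq {a b u : S} (h : a = u * b) : RLe (lcone a) (lcone b) :=
  ⟨lcone u, by rw [lcone_mul, h]⟩

theorem of_lcone_eq_idem (a : S) : ∃ e, IsIdempotentElem e ∧
    RClass.of (lcone a) = RClass.of (lcone e) := by
  obtain ⟨x, hx, -⟩ := RegularSemigroup.exists_inverse a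
  refine ⟨x * a, ?_, le_antisymm (lcone_rle_of_eq (u := a) ?_) (lcone_rle_of_eq rfl)⟩
  · change x * a * (x * a) = x * a
    rw [mul_assoc, ← mul_assoc a, hx]
  · rw [← mul_assoc, hx]

variable (S) in
/-- The down-set of the classes of the principal cones `l^e`, `e` idempotent. (An `R`-class of
the semigroup of cones is an `L`-class of the opposite semigroup.) -/
def lclasses : LowerSet (RClass (NCone (RCat S))) where
  carrier := {d | ∃ e : S, IsIdempotentElem e ∧ d = RClass.of (lcone e)}
  lower' := by
    rintro _ d hd ⟨e, he, rfl⟩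
    obtain ⟨γ, rfl⟩ := d.exists_of
    obtain ⟨u, rfl⟩ := eq_lcone_of_rle (RClass.of_le_of.1 hd)
    exact of_lcone_eq_idem _

variable (S) in
/-- The right category of a regular semigroup, connected by the classes of its principal
cones. -/
def toCC : CC.{u} where
  carrier := RCat S
  D := lclasses S
  connected X := by
    obtain ⟨e, he, heX, h⟩ := exists_idem X
    exact ⟨_, ⟨e, he, rfl⟩, lcone e, lcone_idem he, eq_principal heX h, rfl⟩

theorem lcone_injective [RightReductive S] {a b : S} (h : lcone a = lcone b) : a = b := by
  refine RightReductive.injective (funext fun x => ?_)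
  have key : ∀ γ : NCone (RCat S), γ = lcone b →
      (ap (γ.app (principal x)) ⟨x, mem_principal x⟩ : S) = b * x := by
    rintro _ rfl
    rfl
  exact (key _ h : a * x = b * x)

theorem exists_of_lcone_le [RightReductive S] {a b : S} (h : RLe (lcone a) (lcone b)) :
    ∃ u, a = u * b := by
  obtain ⟨u, h⟩ := eq_lcone_of_rle h
  exact ⟨u, lcone_injective h⟩

variable [RegularSemigroup S']

theorem mapObj_principal (φ : S →ₙ* S') (a : S) : mapObj φ (principal a) = principal (φ a) := by
  refine RCat.ext (Set.ext fun y => ⟨?_, ?_⟩)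
  · rintro ⟨_, ⟨s, rfl⟩, t, rfl⟩
    exact ⟨φ s * t, by rw [map_mul, mul_assoc]⟩
  · rintro ⟨t, rfl⟩
    exact ⟨a, mem_principal a, t, rfl⟩

variable [RightReductive S]

theorem map_class_le (φ : S →ₙ* S') {a b : S}
    (h : RClass.of (lcone a) ≤ RClass.of (lcone b)) :
    RClass.of (lcone (φ a)) ≤ RClass.of (lcone (φ b)) := by
  obtain ⟨u, rfl⟩ := exists_of_lcone_le (RClass.of_le_of.1 h)
  exact RClass.of_le_of.2 (lcone_rle_of_eq (map_mul φ u b))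

/-- The map of down-sets induced by a homomorphism `φ`: it sends the class of `l^e` to the
class of `l^(φ e)`. -/
noncomputable def mapClass (φ : S →ₙ* S') : lclasses S →o lclasses S' where
  toFun d := ⟨RClass.of (lcone (φ d.2.choose)), φ d.2.choose,
    d.2.choose_spec.1.map φ, rfl⟩
  monotone' d d' h := map_class_le φ (by
    rw [← d.2.choose_spec.2, ← d'.2.choose_spec.2]; exact h)

/-- The value of `mapClass` does not depend on the element `a` that represents the class. -/
theorem mapClass_eq (φ : S →ₙ* S') (d : lclasses S) {a : S}
    (h : RClass.of (lcone a) = d.1) : (mapClass φ d).1 = RClass.of (lcone (φ a)) := by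
  have e := h.trans d.2.choose_spec.2
  exact le_antisymm (map_class_le φ e.ge) (map_class_le φ e.le)

/-- The CC-morphism induced by a homomorphism. -/
noncomputable def mapCC (φ : S →ₙ* S') : toCC S ⟶ toCC S' where
  F := mapFunctor φ
  map_incl {X Y} j hj y := by
    obtain ⟨e, he, heX, h⟩ := exists_idem X
    refine (ap_mapHom φ j (u := e) (fun x => ?_) y).trans ?_
    · rw [h x x.2, hj]
    · obtain ⟨_, x, hx, s, rfl⟩ := y
      change φ e * (φ x * s) = φ x * s
      rw [← mul_assoc, ← map_mul, h x hx]
  G := mapClass φ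
  map_connected := by
    rintro c d ⟨ε, hε, rfl, hd⟩
    obtain ⟨e, he, hde⟩ := d.2
    obtain ⟨u, rfl⟩ := eq_lcone_of_rle (RClass.of_le_of.1 (hd.trans hde).le)
    have hu : IsIdempotentElem (u * e) := lcone_injective ((lcone_mul _ _).symm.trans hε)
    exact ⟨lcone (φ (u * e)), lcone_idem (hu.map φ), (mapObj_principal φ _).symm,
      (mapClass_eq φ d hd).symm⟩
  map_app := by
    rintro d ε ε' hε hd hε' hd' hv X
    obtain ⟨e, he, hde⟩ := d.2
    obtain ⟨u, rfl⟩ := eq_lcone_of_rle (RClass.of_le_of.1 (hd.trans hde).le)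
    have hu : IsIdempotentElem (u * e) := lcone_injective ((lcone_mul _ _).symm.trans hε)
    have h' : ε' = lcone (φ (u * e)) := NCone.idem_unique hε' (lcone_idem (hu.map φ))
      (RClass.of_le_of.1 (hd'.trans (mapClass_eq φ d hd)).le)
      (hv.trans (mapObj_principal φ _))
    subst h'
    refine hom_ext fun y => (ap_eqToHom _ _).trans ?_
    exact ap_mapHom φ _ (fun x => ap_lcone (u * e) x) y

end RCat

end RightCategory

theorem CC.hom_ext {X Y : CC.{u}} {m n : X ⟶ Y} (hF : CC.Hom.F m = CC.Hom.F n)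
    (hG : ∀ d, CC.Hom.G m d = CC.Hom.G n d) : m = n :=
  CC.Hom.ext hF (OrderHom.ext _ _ (funext hG))

/-- The functor from right reductive regular semigroups to connected categories: it sends a
semigroup to its right category, connected by the classes of its principal cones. -/
noncomputable def RRS.toCC : RRS.{u} ⥤ CC.{u} where
  obj S := RCat.toCC S.obj
  map φ := RCat.mapCC φ.hom.hom
  map_id S := CC.hom_ext RCat.mapFunctor_id fun d => Subtype.ext d.2.choose_spec.2.symm
  map_comp {S S' S''} φ ψ := by
    refine CC.hom_ext (RCat.mapFunctor_comp φ.hom.hom ψ.hom.hom) fun d => Subtype.ext ?_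
    have h := d.2.choose_spec.2.symm
    refine (RCat.mapClass_eq _ d h).trans ?_
    exact (RCat.mapClass_eq ψ.hom.hom (RCat.mapClass φ.hom.hom d)
      (RCat.mapClass_eq φ.hom.hom d h).symm).symm

end ConnCat

/-! For a regular semigroup `S`, sending `a` to the principal cone `l^a` is an antihomomorphism
onto the connection semigroup of `C(S)`, and it is injective as soon as `S` is right reductive; this
is the unit `S ≅ S(C(S))`.

For the counit `X ≅ C(S(X))` an object `c` goes to the right ideal of all cones whose vertex is
contained in `c`. Since every object is connected, a morphism `f : c ⟶ c'` is, up to an inclusion,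
the component at `c` of some cone `ρ` of the connection semigroup; multiplication by `ρ` maps the
right ideal of `c` into that of `c'`, and on that ideal it depends only on `f`. This gives an
isomorphism of categories, and a CC-morphism `(F, G)` with `F` an isomorphism and `G` surjective is
invertible: both the order of `R`-classes and the connection of objects by classes can be read off
from morphisms between vertices of cones, so a fully faithful `F` reflects them. -/

namespace ConnCat

/-! ### Inclusions and cones in normal categories -/

section Subobjects

variable {C : Type u} [SmallCategory C] [CategoryWithSubobjects C]

/-- The relation `a ⪯ b` between objects: there is an inclusion `j(a, b)` of `a` into `b`. -/
def InclLE (a b : C) : Prop := ∃ j : a ⟶ b, IsIncl j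

theorem InclLE.refl (a : C) : InclLE a a := ⟨𝟙 a, CategoryWithSubobjects.incl_id a⟩

theorem InclLE.trans {a b c : C} : InclLE a b → InclLE b c → InclLE a c
  | ⟨i, hi⟩, ⟨j, hj⟩ => ⟨i ≫ j, CategoryWithSubobjects.incl_comp i j hi hj⟩

theorem InclLE.antisymm {a b : C} : InclLE a b → InclLE b a → a = b
  | ⟨i, hi⟩, ⟨j, hj⟩ => CategoryWithSubobjects.incl_antisymm i j hi hj

theorem IsIncl.comp {a b c : C} {i : a ⟶ b} {j : b ⟶ c} (hi : IsIncl i) (hj : IsIncl j) :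
    IsIncl (i ≫ j) :=
  CategoryWithSubobjects.incl_comp i j hi hj

theorem IsIncl.eq_eqToHom {a b : C} {i : a ⟶ b} (hi : IsIncl i) (h : a = b) : i = eqToHom h :=
  CategoryWithSubobjects.incl_unique i _ hi (NCone.isIncl_eqToHom h)

theorem IsIncl.eq_of_isIso {a b : C} {i : a ⟶ b} (hi : IsIncl i) [IsIso i] : a = b := by
  have hinv : IsIncl (inv i) := CategoryWithSubobjects.incl_of_comp (inv i) i
    (by rw [IsIso.inv_hom_id]; exact CategoryWithSubobjects.incl_id b) hi
  exact CategoryWithSubobjects.incl_antisymm i (inv i) hi hinv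

instance [NormalCategory C] : Balanced C where
  isIso_of_mono_of_epi p _ _ := by
    obtain ⟨a', q, u, ⟨j, -, hjq⟩, hu, rfl⟩ := epi_factor p
    have : Mono q := mono_of_mono q u
    have hqj : q ≫ j = 𝟙 _ := by
      rw [← cancel_mono q, Category.assoc, hjq, Category.comp_id, Category.id_comp]
    have : IsIso q := ⟨j, hqj, hjq⟩
    infer_instance

/-- The epimorphic part of `j` is an isomorphism that `F` maps to an inclusion, hence to an identity
up to equality of objects. -/
theorem isIncl_of_map {D : Type u} [SmallCategory D] [CategoryWithSubobjects D] [NormalCategory C]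
    (F : C ⥤ D) [F.Faithful] (hF : Function.Injective F.obj)
    (map_incl : ∀ {a b : C} (j : a ⟶ b), IsIncl j → IsIncl (F.map j))
    {a b : C} {j : a ⟶ b} (hj : IsIncl (F.map j)) : IsIncl j := by
  obtain ⟨hp, hi, hpi⟩ := canonicalFactorisation_spec j
  have hFp : IsIncl (F.map (epiPart j)) := CategoryWithSubobjects.incl_of_comp _ _
    (by rw [← F.map_comp, ← hpi]; exact hj) (map_incl _ hi)
  have : Mono (epiPart j) := F.mono_of_mono_map hFp.mono
  have : IsIso (epiPart j) := isIso_of_mono_of_epi _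
  have him : a = im j := hF hFp.eq_of_isIso
  have hp' : epiPart j = eqToHom him := F.map_injective (by
    rw [eqToHom_map]; exact hFp.eq_eqToHom _)
  rw [hpi, hp']
  exact (NCone.isIncl_eqToHom him).comp hi

end Subobjects

namespace NCone

variable {C : Type u} [SmallCategory C] [CategoryWithSubobjects C]

theorem eqToHom_app (γ : NCone C) {a b : C} (h : a = b) : eqToHom h ≫ γ.app b = γ.app a :=
  γ.compat _ (isIncl_eqToHom h)

/-- The cone `γ` realises `f : c ⟶ c'` if its component at `c` is `f` up to an inclusion of its
vertex into `c'`. -/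
def Realises (γ : NCone C) {c c' : C} (f : c ⟶ c') : Prop :=
  ∃ i : γ.vertex ⟶ c', IsIncl i ∧ γ.app c ≫ i = f

theorem realises_app (γ : NCone C) (c : C) : γ.Realises (γ.app c) :=
  ⟨𝟙 _, CategoryWithSubobjects.incl_id _, Category.comp_id _⟩

namespace Realises

variable {γ δ : NCone C} {c c' c'' : C} {f : c ⟶ c'}

theorem vertex_inclLE (h : γ.Realises f) : InclLE γ.vertex c' :=
  let ⟨i, hi, _⟩ := h
  ⟨i, hi⟩

theorem app_comp (h : γ.Realises f) {i : γ.vertex ⟶ c'} (hi : IsIncl i) : γ.app c ≫ i = f := by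
  obtain ⟨j, hj, rfl⟩ := h
  rw [CategoryWithSubobjects.incl_unique i j hi hj]

theorem unique {g : c ⟶ c'} (hf : γ.Realises f) (hg : γ.Realises g) : f = g := by
  obtain ⟨i, hi, rfl⟩ := hf
  exact hg.app_comp hi

theorem comp_incl (h : γ.Realises f) {j : c' ⟶ c''} (hj : IsIncl j) : γ.Realises (f ≫ j) := by
  obtain ⟨i, hi, rfl⟩ := h
  exact ⟨i ≫ j, hi.comp hj, (Category.assoc _ _ _).symm⟩

theorem mul [NormalCategory C] (hf : γ.Realises f) {g : c' ⟶ c''} (hg : δ.Realises g) :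
    (γ * δ).Realises (f ≫ g) := by
  obtain ⟨i, hi, rfl⟩ := hf
  obtain ⟨j, hj, rfl⟩ := hg
  refine ⟨mulIncl γ δ ≫ j, (isIncl_mulIncl γ δ).comp hj, ?_⟩
  rw [← Category.assoc, mul_app, ← δ.compat i hi]
  simp only [Category.assoc]

end Realises

variable {γ δ ε : NCone C}

theorem eq_of_realises {b : C} {f : ∀ c, c ⟶ b} (hγ : ∀ c, γ.Realises (f c))
    (hδ : ∀ c, δ.Realises (f c)) : γ = δ := by
  obtain ⟨i, hi⟩ := (hγ b).vertex_inclLE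
  obtain ⟨k, hk⟩ := (hδ b).vertex_inclLE
  exact eq_of_incl i k hi hk fun c => ((hγ c).app_comp hi).trans ((hδ c).app_comp hk).symm

variable [NormalCategory C]

theorem mul_vertex_inclLE (γ δ : NCone C) : InclLE (γ * δ).vertex δ.vertex :=
  ⟨mulIncl γ δ, isIncl_mulIncl γ δ⟩

theorem realises_of_isIncl (hε : IsIdempotentElem ε) {c : C} {j : ε.vertex ⟶ c} (hj : IsIncl j) :
    ε.Realises j :=
  ⟨j, hj, by rw [app_vertex_of_idem hε, Category.id_comp]⟩

theorem realises_id (hε : IsIdempotentElem ε) : ε.Realises (𝟙 ε.vertex) :=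
  realises_of_isIncl hε (CategoryWithSubobjects.incl_id _)

theorem exists_realises {c c' : C} {d : RClass (NCone C)} (hc : ConnectedBy c d) (f : c ⟶ c') :
    ∃ ρ : NCone C, RClass.of ρ ≤ d ∧ ρ.Realises f := by
  obtain ⟨ε, hε, rfl, rfl⟩ := hc
  obtain ⟨hp, hi, hf⟩ := canonicalFactorisation_spec f
  refine ⟨ε.star (epiPart f) hp, star_rle hε _ _, imIncl f, hi, ?_⟩
  change (ε.app ε.vertex ≫ epiPart f) ≫ imIncl f = f
  rw [app_vertex_of_idem hε, Category.id_comp, ← hf]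

theorem mul_eq_mul_of_realises {c c' : C} {f : c ⟶ c'} (hγ : InclLE γ.vertex c)
    (hδ : δ.Realises f) (hε : ε.Realises f) : γ * δ = γ * ε := by
  obtain ⟨k, hk⟩ := hγ
  have hγk (b : C) : γ.Realises (γ.app b ≫ k) := (γ.realises_app b).comp_incl hk
  exact eq_of_realises (fun b => (hγk b).mul hδ) fun b => (hγk b).mul hε

theorem mul_idem_eq (hε : IsIdempotentElem ε) (hγ : InclLE γ.vertex ε.vertex) : γ * ε = γ := by
  obtain ⟨k, hk⟩ := hγ
  have hγk (b : C) : γ.Realises (γ.app b ≫ k) := (γ.realises_app b).comp_incl hk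
  refine eq_of_realises (fun b => ?_) hγk
  simpa only [Category.comp_id] using (hγk b).mul (realises_id hε)

theorem rle_iff_exists_app {σ ρ : NCone C} :
    RLe σ ρ ↔ ∃ f : ρ.vertex ⟶ σ.vertex, ∀ c, σ.app c = ρ.app c ≫ f := by
  refine ⟨rle_app, fun ⟨f, hf⟩ => ?_⟩
  obtain ⟨ν, hν, hv⟩ := exists_idem ρ.vertex
  obtain ⟨τ, -, hτ⟩ := exists_realises ⟨ν, hν, hv, rfl⟩ f
  exact ⟨τ, eq_of_realises σ.realises_app fun c => hf c ▸ (ρ.realises_app c).mul hτ⟩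

theorem of_eq_of_iff_exists_isIso {σ ρ : NCone C} :
    RClass.of σ = RClass.of ρ ↔
      ∃ f : ρ.vertex ⟶ σ.vertex, IsIso f ∧ ∀ c, σ.app c = ρ.app c ≫ f := by
  constructor
  · intro h
    obtain ⟨f, hf⟩ := rle_app (RClass.of_le_of.1 h.le)
    obtain ⟨g, hg⟩ := rle_app (RClass.of_le_of.1 h.ge)
    obtain ⟨a, ha⟩ := ρ.exists_iso
    obtain ⟨b, hb⟩ := σ.exists_iso
    refine ⟨f, ⟨g, ?_, ?_⟩, hf⟩
    · rw [← cancel_epi (ρ.app a), ← Category.assoc, ← hf, ← hg, Category.comp_id]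
    · rw [← cancel_epi (σ.app b), ← Category.assoc, ← hg, ← hf, Category.comp_id]
  · rintro ⟨f, hf, h⟩
    refine le_antisymm (rle_iff_exists_app.2 ⟨f, h⟩) (rle_iff_exists_app.2 ⟨inv f, fun c => ?_⟩)
    rw [h, Category.assoc, IsIso.hom_inv_id, Category.comp_id]

end NCone

/-! ### Isomorphisms of connected categories -/

section StrictInverse

variable {C D : Type*} [Category* C] [Category* D] (F : C ⥤ D) [F.IsIso]

theorem obj_strictInv_obj (x : D) : F.obj (F.strictInv.obj x) = x :=
  Functor.congr_obj F.asIsomorphism.counit_eq x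

theorem map_strictInv_map {x y : D} (f : x ⟶ y) : F.map (F.strictInv.map f) =
    eqToHom (obj_strictInv_obj F x) ≫ f ≫ eqToHom (obj_strictInv_obj F y).symm :=
  Functor.congr_hom F.asIsomorphism.counit_eq f

end StrictInverse

namespace CC

variable {X Y : CC.{u}}

theorem mem_connSemigroup {γ : NCone X.carrier} {d : X.D} (h : RClass.of γ = d.1) :
    γ ∈ X.connSemigroup := by
  change RClass.of γ ∈ X.D
  exact h ▸ d.2

theorem exists_of_eq (d : X.D) : ∃ γ : X.connSemigroup, RClass.of γ.1 = d.1 := by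
  obtain ⟨γ, hγ⟩ := d.1.exists_of
  exact ⟨⟨γ, mem_connSemigroup hγ⟩, hγ⟩

namespace Hom

variable (m : X ⟶ Y)

theorem mapCone_app (γ : X.connSemigroup) :
    ∃ h : (mapCone m γ).1.vertex = m.F.obj γ.1.vertex,
      ∀ c, (mapCone m γ).1.app (m.F.obj c) ≫ eqToHom h = m.F.map (γ.1.app c) := by
  have h : (mapCone m γ).1.vertex = m.F.obj γ.1.vertex := by
    obtain ⟨_, _, _, _, _, _, _, -, -, -, -, hγ, hγ'⟩ := (mapCone_eq_iff m γ _).1 rfl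
    rw [hγ', hγ]
    rfl
  obtain ⟨-, i, hi, happ⟩ := mapCone_spec m γ
  exact ⟨h, fun c => hi.eq_eqToHom h ▸ happ c⟩

theorem mapCone_realises {γ : X.connSemigroup} {c c' : X.carrier} {f : c ⟶ c'}
    (h : γ.1.Realises f) : (mapCone m γ).1.Realises (m.F.map f) := by
  obtain ⟨i, hi, rfl⟩ := h
  obtain ⟨-, j, hj, happ⟩ := mapCone_spec m γ
  refine ⟨j ≫ m.F.map i, hj.comp (m.map_incl i hi), ?_⟩
  rw [← Category.assoc, happ, ← Functor.map_comp]

theorem of_mapCone {γ : X.connSemigroup} {d : X.D} (h : RClass.of γ.1 = d.1) :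
    RClass.of (mapCone m γ).1 = (m.G d).1 := by
  rw [(mapCone_spec m γ).1]
  exact congrArg (fun d => (m.G d).1) (Subtype.ext h)

theorem le_of_map_le [m.F.Full] [m.F.Faithful] {d d' : X.D} (h : m.G d ≤ m.G d') : d ≤ d' := by
  obtain ⟨γ, hγ⟩ := X.exists_of_eq d
  obtain ⟨δ, hδ⟩ := X.exists_of_eq d'
  replace h : (m.G d).1 ≤ (m.G d').1 := h
  rw [← of_mapCone m hγ, ← of_mapCone m hδ, RClass.of_le_of, NCone.rle_iff_exists_app] at h
  obtain ⟨f, hf⟩ := h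
  obtain ⟨hγv, hγa⟩ := mapCone_app m γ
  obtain ⟨hδv, hδa⟩ := mapCone_app m δ
  change d.1 ≤ d'.1
  rw [← hγ, ← hδ, RClass.of_le_of, NCone.rle_iff_exists_app]
  refine ⟨m.F.preimage (eqToHom hδv.symm ≫ f ≫ eqToHom hγv), fun c => m.F.map_injective ?_⟩
  rw [Functor.map_comp, Functor.map_preimage, ← hγa, ← hδa, hf]
  simp only [Category.assoc, eqToHom_trans_assoc, eqToHom_refl, Category.id_comp]

theorem connectedBy_of_map [m.F.Full] [m.F.Faithful] {c : X.carrier} {d : X.D}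
    (h : ConnectedBy (m.F.obj c) (m.G d).1) : ConnectedBy c d.1 := by
  obtain ⟨γ, hγ⟩ := X.exists_of_eq d
  obtain ⟨ε', hε', hv, hd⟩ := h
  obtain ⟨f, hf, hfa⟩ := NCone.of_eq_of_iff_exists_isIso.1 (hd.trans (of_mapCone m hγ).symm)
  obtain ⟨hγv, hγa⟩ := mapCone_app m γ
  let u : γ.1.vertex ⟶ c := m.F.preimage (eqToHom hγv.symm ≫ f ≫ eqToHom hv)
  have hFu : m.F.map u = eqToHom hγv.symm ≫ f ≫ eqToHom hv := m.F.map_preimage _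
  have : IsIso (m.F.map u) := by rw [hFu]; infer_instance
  have hu : IsIso u := isIso_of_fully_faithful m.F u
  refine ⟨γ.1.star u inferInstance, NCone.idem_of_app (m.F.map_injective ?_), rfl,
    (NCone.of_eq_of_iff_exists_isIso.2 ⟨u, hu, fun _ => rfl⟩).trans hγ⟩
  change m.F.map (γ.1.app c ≫ u) = m.F.map (𝟙 c)
  rw [Functor.map_comp, hFu, ← hγa, CategoryTheory.Functor.map_id]
  simp only [Category.assoc, eqToHom_trans_assoc, eqToHom_refl, Category.id_comp]
  rw [← Category.assoc, ← hfa, NCone.app_eq_eqToHom hε' hv, eqToHom_trans, eqToHom_refl]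

theorem isIso_of_isIso_functor [m.F.IsIso] (hG : Function.Surjective m.G) : IsIso m := by
  obtain ⟨t, ht⟩ := hG.hasRightInverse
  have hs := obj_strictInv_obj m.F
  let n : Y ⟶ X :=
    { F := m.F.strictInv
      map_incl := fun j hj => isIncl_of_map m.F m.F.bijective_obj.1 m.map_incl (by
        rw [map_strictInv_map]
        exact (NCone.isIncl_eqToHom _).comp (hj.comp (NCone.isIncl_eqToHom _)))
      G := ⟨t, fun d d' h => le_of_map_le m (by rwa [ht, ht])⟩
      map_connected := fun c d h => connectedBy_of_map m (by
        change ConnectedBy (m.F.obj (m.F.strictInv.obj c)) (m.G (t d)).1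
        rwa [hs, ht])
      map_app := fun d ε ε' hε hd hε' hd' hv c => m.F.map_injective (by
        have hεv : ε.vertex = m.F.obj ε'.vertex := by rw [hv, hs]
        have key := m.map_app (t d) ε' ε hε' hd' hε (by rw [ht, hd]) hεv (m.F.strictInv.obj c)
        rw [Functor.map_comp, map_strictInv_map, eqToHom_map, ← cancel_mono (eqToHom hεv.symm),
          key, ← ε.eqToHom_app (hs c)]
        simp only [Category.assoc, eqToHom_trans, eqToHom_refl, Category.comp_id]) }
  refine ⟨n, CC.hom_ext m.F.asIsomorphism.unit_eq.symm fun d => ?_,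
    CC.hom_ext m.F.asIsomorphism.counit_eq ht⟩
  exact le_antisymm (le_of_map_le m (ht _).le) (le_of_map_le m (ht _).ge)

end Hom

end CC

/-! ### The unit -/

namespace RCat

variable {S S' : Type u} [Semigroup S] [RegularSemigroup S] [Semigroup S'] [RegularSemigroup S']

theorem of_lcone_mem_lclasses (a : S) : RClass.of (lcone a) ∈ lclasses S :=
  of_lcone_eq_idem a

/-- The homomorphism `a ↦ l^a` from `S` to the dual connection semigroup of its right category. -/
noncomputable def lconeHom (S : Type u) [Semigroup S] [RegularSemigroup S] :
    S →ₙ* (toCC S).dualConnSemigroup where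
  toFun a := MulOpposite.op ⟨lcone a, of_lcone_mem_lclasses a⟩
  map_mul' a b := MulOpposite.unop_injective (Subtype.ext (lcone_mul b a).symm)

theorem lconeHom_bijective [RightReductive S] : Function.Bijective (lconeHom S) := by
  constructor
  · intro a b h
    exact lcone_injective (congrArg (fun γ => γ.unop.1) h)
  · rintro ⟨γ, e, -, hγ⟩
    obtain ⟨u, rfl⟩ := eq_lcone_of_rle (RClass.of_le_of.1 hγ.le)
    exact ⟨u * e, rfl⟩

theorem mapCone_lcone [RightReductive S] (φ : S →ₙ* S') (a : S) :
    CC.Hom.mapCone (mapCC φ) ⟨lcone a, of_lcone_mem_lclasses a⟩ =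
      ⟨lcone (φ a), of_lcone_mem_lclasses (φ a)⟩ := by
  refine CC.Hom.mapCone_unique _ _ _ (mapClass_eq φ _ rfl).symm
    ⟨eqToHom (mapObj_principal φ a).symm, NCone.isIncl_eqToHom _, fun X => hom_ext fun y => ?_⟩
  exact (ap_eqToHom _ _).trans (ap_mapHom φ _ (ap_lcone a) y).symm

end RCat

/-- The isomorphism of a right reductive regular semigroup `S` with the semigroup `S(C(S))`, as a
morphism of `RRS`. -/
noncomputable def RRS.lconeIso (S : RRS.{u}) : S ≅ CC.toRRS.obj (RRS.toCC.obj S) :=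
  isRRS.isoMk (MulEquiv.toSemigrpIso (Y := (RCat.toCC S.obj).dualConnSemigroup)
    (MulEquiv.ofBijective (RCat.lconeHom S.obj) RCat.lconeHom_bijective))

/-- The unit `S ≅ S(C(S))` of the equivalence. -/
noncomputable def unitNatIso : 𝟭 RRS.{u} ≅ RRS.toCC ⋙ CC.toRRS :=
  NatIso.ofComponents RRS.lconeIso fun {S S'} φ => by
    ext a
    exact (congrArg MulOpposite.op (RCat.mapCone_lcone φ.hom.hom a)).symm

/-! ### The counit -/

theorem RLe.of_coe {S : Type u} [Semigroup S] {T : Subsemigroup S} [RegularSemigroup T] {a b : T}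
    (h : RLe (a : S) b) : RLe a b := by
  obtain ⟨x, hx⟩ := h
  obtain ⟨y, hy, -⟩ := RegularSemigroup.exists_inverse b
  have hy : (b : S) * y * b = b := congrArg Subtype.val hy
  refine ⟨y * a, Subtype.ext ?_⟩
  calc (a : S) = b * y * b * x := by rw [hy, hx]
    _ = b * (y * a) := by rw [hx]; simp only [mul_assoc]

namespace CC

open MulOpposite

variable {X Y : CC.{u}}

theorem exists_idem (c : X.carrier) :
    ∃ ε : X.connSemigroup, IsIdempotentElem ε.1 ∧ ε.1.vertex = c := by
  obtain ⟨d, hd, ε, hε, hv, rfl⟩ := X.connected c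
  exact ⟨⟨ε, hd⟩, hε, hv⟩

theorem exists_realises {c c' : X.carrier} (f : c ⟶ c') :
    ∃ ρ : X.connSemigroup, ρ.1.Realises f := by
  obtain ⟨d, hd, hc⟩ := X.connected c
  obtain ⟨ρ, hρd, hρ⟩ := NCone.exists_realises hc f
  exact ⟨⟨ρ, X.D.lower hρd hd⟩, hρ⟩

theorem op_mul_eq {ε : X.connSemigroup} (hε : IsIdempotentElem ε.1) (γ : X.dualConnSemigroup)
    (hγ : InclLE γ.unop.1.vertex ε.1.vertex) : op ε * γ = γ :=
  unop_injective (Subtype.ext (NCone.mul_idem_eq hε hγ))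

/-- The right ideal of the dual connection semigroup that corresponds to an object `c`: the cones
with vertex contained in `c`. It is generated by any idempotent cone with vertex `c`. -/
def ideal (c : X.carrier) : RCat X.dualConnSemigroup where
  ideal := {γ | InclLE γ.unop.1.vertex c}
  exists_eq := by
    obtain ⟨ε, hε, rfl⟩ := X.exists_idem c
    refine ⟨op ε, congrArg op (Subtype.ext hε), Set.ext fun γ => ⟨fun hγ => ?_, ?_⟩⟩
    · exact ⟨γ, (op_mul_eq hε γ hγ).symm⟩
    · rintro ⟨γ, rfl⟩
      exact NCone.mul_vertex_inclLE _ _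

theorem op_mem_ideal (γ : X.connSemigroup) : op γ ∈ (ideal γ.1.vertex).ideal :=
  InclLE.refl γ.1.vertex

theorem principal_op {ε : X.connSemigroup} (hε : IsIdempotentElem ε.1) :
    RCat.principal (op ε) = ideal ε.1.vertex :=
  RCat.eq_principal (op_mem_ideal ε) (op_mul_eq hε)

theorem inclLE_of_ideal_eq {c c' : X.carrier} (h : ideal c = ideal c') : InclLE c c' := by
  obtain ⟨ε, -, rfl⟩ := X.exists_idem c
  exact (h ▸ op_mem_ideal ε : op ε ∈ (ideal c').ideal)

theorem ideal_bijective : Function.Bijective (ideal (X := X)) := by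
  refine ⟨fun c c' h => (inclLE_of_ideal_eq h).antisymm (inclLE_of_ideal_eq h.symm), fun Z => ?_⟩
  obtain ⟨⟨ε⟩, hε, heZ, h⟩ := Z.exists_idem
  replace hε : IsIdempotentElem ε.1 := congrArg (fun γ : X.dualConnSemigroup => γ.unop.1) hε
  exact ⟨ε.1.vertex, (principal_op hε).symm.trans (RCat.eq_principal heZ h)⟩

theorem op_mul_mem_ideal {c c' : X.carrier} {f : c ⟶ c'} {ρ : X.connSemigroup}
    (hρ : ρ.1.Realises f) (γ : X.dualConnSemigroup) : op ρ * γ ∈ (ideal c').ideal :=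
  (NCone.mul_vertex_inclLE γ.unop.1 ρ.1).trans hρ.vertex_inclLE

/-- The map of right ideals induced by a morphism `f`: multiplication by any cone that realises
`f`. -/
noncomputable def idealMap {c c' : X.carrier} (f : c ⟶ c') : ideal c ⟶ ideal c' :=
  RCat.mulHom (op (X.exists_realises f).choose) fun γ _ =>
    op_mul_mem_ideal (X.exists_realises f).choose_spec γ

theorem ap_idealMap {c c' : X.carrier} {f : c ⟶ c'} {ρ : X.connSemigroup} (hρ : ρ.1.Realises f)
    (γ : (ideal c).ideal) : (RCat.ap (idealMap f) γ : X.dualConnSemigroup) = op ρ * γ :=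
  congrArg op (Subtype.ext
    (NCone.mul_eq_mul_of_realises γ.2 (X.exists_realises f).choose_spec hρ))

/-- The functor from `X` to the right category of its dual connection semigroup. -/
noncomputable def idealFunctor (X : CC.{u}) : X.carrier ⥤ RCat X.dualConnSemigroup where
  obj := ideal
  map := idealMap
  map_id c := by
    obtain ⟨ε, hε, rfl⟩ := X.exists_idem c
    exact RCat.hom_ext fun γ =>
      (ap_idealMap (NCone.realises_id hε) γ).trans (op_mul_eq hε _ γ.2)
  map_comp f g := by
    obtain ⟨ρ, hρ⟩ := X.exists_realises f
    obtain ⟨σ, hσ⟩ := X.exists_realises g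
    refine RCat.hom_ext fun γ => ?_
    rw [RCat.ap_comp, ap_idealMap hσ, ap_idealMap hρ,
      ap_idealMap (ρ := ρ * σ) (hρ.mul hσ), op_mul, mul_assoc]

theorem realises_of_ap_idealMap {ε γ : X.connSemigroup} (hε : IsIdempotentElem ε.1)
    {c : X.carrier} {f : ε.1.vertex ⟶ c}
    (h : RCat.ap (idealMap f) ⟨op ε, op_mem_ideal ε⟩ = op γ) : γ.1.Realises f := by
  obtain ⟨ρ, hρ⟩ := X.exists_realises f
  rw [ap_idealMap hρ] at h
  obtain rfl : ε * ρ = γ := congrArg unop h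
  have := (NCone.realises_id hε).mul hρ
  rwa [Category.id_comp] at this

instance : X.idealFunctor.Faithful where
  map_injective {c c'} f g h := by
    obtain ⟨ε, hε, rfl⟩ := X.exists_idem c
    replace h : idealMap f = idealMap g := h
    exact (realises_of_ap_idealMap hε rfl).unique (realises_of_ap_idealMap hε (by rw [← h]; rfl))

instance : X.idealFunctor.Full where
  map_surjective {c c'} h := by
    obtain ⟨ε, hε, rfl⟩ := X.exists_idem c
    obtain ⟨⟨ρ⟩, hρ⟩ := RCat.exists_mul h
    obtain ⟨k, hk⟩ : InclLE (ε * ρ).1.vertex c' := by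
      have := (RCat.ap h ⟨op ε, op_mem_ideal ε⟩).2
      rwa [hρ] at this
    have hερ := ((ε * ρ).1.realises_app ε.1.vertex).comp_incl hk
    refine ⟨_, RCat.hom_ext fun γ => (ap_idealMap hερ γ).trans ?_⟩
    rw [op_mul, mul_assoc, op_mul_eq hε _ γ.2]
    exact (hρ γ).symm

instance : X.idealFunctor.IsIso where
  bijective_obj := ideal_bijective

theorem isIncl_idealMap {c c' : X.carrier} {j : c ⟶ c'} (hj : IsIncl j) :
    IsIncl (idealMap j) := by
  obtain ⟨ε, hε, rfl⟩ := X.exists_idem c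
  exact fun γ => (ap_idealMap (NCone.realises_of_isIncl hε hj) γ).trans (op_mul_eq hε _ γ.2)

theorem lcone_op_rle {γ δ : X.connSemigroup} (h : RLe γ.1 δ.1) :
    RLe (RCat.lcone (op γ)) (RCat.lcone (op δ)) := by
  obtain ⟨x, rfl⟩ := RLe.of_coe h
  exact RCat.lcone_rle_of_eq (op_mul δ x)

/-- The map of down-sets sending the class of a cone `γ` to the class of the principal cone
`l^γ`. -/
noncomputable def classMap (X : CC.{u}) : X.D →o RCat.lclasses X.dualConnSemigroup where
  toFun d := ⟨RClass.of (RCat.lcone (op (X.exists_of_eq d).choose)), RCat.of_lcone_mem_lclasses _⟩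
  monotone' d d' h := RClass.of_le_of.2 (lcone_op_rle (RClass.of_le_of.1 (by
    rwa [(X.exists_of_eq d).choose_spec, (X.exists_of_eq d').choose_spec])))

theorem classMap_eq {d : X.D} {γ : X.connSemigroup} (h : RClass.of γ.1 = d.1) :
    (X.classMap d).1 = RClass.of (RCat.lcone (op γ)) := by
  have h' := (X.exists_of_eq d).choose_spec.trans h.symm
  exact le_antisymm (lcone_op_rle (RClass.of_le_of.1 h'.le))
    (lcone_op_rle (RClass.of_le_of.1 h'.ge))

theorem classMap_surjective : Function.Surjective X.classMap := by
  rintro ⟨_, ⟨ε⟩, -, rfl⟩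
  exact ⟨⟨_, ε.2⟩, Subtype.ext (classMap_eq rfl)⟩

theorem lcone_op_idem {ε : X.connSemigroup} (hε : IsIdempotentElem ε.1) :
    IsIdempotentElem (RCat.lcone (op ε)) :=
  RCat.lcone_idem (congrArg op (Subtype.ext hε))

/-- The CC-morphism from `X` to the right category of its dual connection semigroup. -/
noncomputable def toRightCategory (X : CC.{u}) : X ⟶ RCat.toCC X.dualConnSemigroup where
  F := X.idealFunctor
  map_incl _ hj := isIncl_idealMap hj
  G := X.classMap
  map_connected := by
    rintro _ d ⟨ε, hε, rfl, hd⟩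
    lift ε to X.connSemigroup using mem_connSemigroup hd
    exact ⟨RCat.lcone (op ε), lcone_op_idem hε, principal_op hε, (classMap_eq hd).symm⟩
  map_app d ε ε' hε hd hε' hd' hv c := by
    lift ε to X.connSemigroup using mem_connSemigroup hd
    obtain rfl : ε' = RCat.lcone (op ε) := NCone.idem_unique hε' (lcone_op_idem hε)
      (RClass.of_le_of.1 (hd'.trans (classMap_eq hd)).le) (hv.trans (principal_op hε).symm)
    refine RCat.hom_ext fun y => (RCat.ap_eqToHom _ _).trans ?_
    exact ap_idealMap (ε.1.realises_app c) y

instance : IsIso X.toRightCategory :=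
  have : (Hom.F X.toRightCategory).IsIso := inferInstanceAs X.idealFunctor.IsIso
  Hom.isIso_of_isIso_functor _ classMap_surjective

/-- The isomorphism of a connected category `X` with `C(S(X))`, as a morphism of `CC`. -/
noncomputable def rightCategoryIso (X : CC.{u}) : X ≅ RCat.toCC X.dualConnSemigroup :=
  asIso X.toRightCategory

/-- The homomorphism of dual connection semigroups induced by a CC-morphism. -/
noncomputable def dualMap (m : X ⟶ Y) : X.dualConnSemigroup →ₙ* Y.dualConnSemigroup :=
  (toRRS.map m).hom.hom

theorem mapCone_idem (m : X ⟶ Y) {ε : X.connSemigroup} (hε : IsIdempotentElem ε.1) :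
    IsIdempotentElem (Hom.mapCone m ε).1 := by
  have h := Hom.mapCone_mul m ε ε
  rw [show ε * ε = ε from Subtype.ext hε] at h
  exact congrArg Subtype.val h.symm

theorem mapObj_ideal (m : X ⟶ Y) (c : X.carrier) :
    RCat.mapObj (dualMap m) (ideal c) = ideal (m.F.obj c) := by
  obtain ⟨ε, hε, rfl⟩ := X.exists_idem c
  obtain ⟨hv, -⟩ := Hom.mapCone_app m ε
  rw [← principal_op hε, ← hv, ← principal_op (mapCone_idem m hε)]
  exact RCat.mapObj_principal _ _

theorem idealMap_map (m : X ⟶ Y) {c c' : X.carrier} (f : c ⟶ c') :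
    idealMap (m.F.map f) = eqToHom (mapObj_ideal m c).symm ≫
      RCat.mapHom (dualMap m) (idealMap f) ≫ eqToHom (mapObj_ideal m c') := by
  obtain ⟨ρ, hρ⟩ := X.exists_realises f
  refine RCat.hom_ext fun y => ?_
  rw [ap_idealMap (Hom.mapCone_realises m hρ), RCat.ap_comp, RCat.ap_comp, RCat.ap_eqToHom,
    RCat.ap_mapHom (dualMap m) (idealMap f) (ap_idealMap hρ), RCat.ap_eqToHom]
  rfl

theorem toRightCategory_naturality (m : X ⟶ Y) :
    m ≫ Y.toRightCategory = X.toRightCategory ≫ RCat.mapCC (dualMap m) := by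
  refine CC.hom_ext (CategoryTheory.Functor.ext (fun c => (mapObj_ideal m c).symm) fun c c' f =>
    idealMap_map m f) fun d => Subtype.ext ?_
  obtain ⟨γ, hγ⟩ := X.exists_of_eq d
  exact (classMap_eq (Hom.of_mapCone m hγ)).trans
    (RCat.mapClass_eq (dualMap m) (X.classMap d) (classMap_eq hγ).symm).symm

end CC

/-- The inverse `X ≅ C(S(X))` of the counit of the equivalence. -/
noncomputable def counitNatIso : 𝟭 CC.{u} ≅ CC.toRRS ⋙ RRS.toCC :=
  NatIso.ofComponents CC.rightCategoryIso fun m => CC.toRightCategory_naturality m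

end ConnCat

theorem mainTheorem6 :
    ∃ e : ConnCat.RRS.{u} ≌ ConnCat.CC.{u},
      e.functor = ConnCat.RRS.toCC ∧ e.inverse = ConnCat.CC.toRRS :=
  ⟨CategoryTheory.Equivalence.mk _ _ ConnCat.unitNatIso ConnCat.counitNatIso.symm, rfl, rfl⟩
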